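/- Let $N=(S,\Sigma,F,m_0)$ be a net system (finite 1-safe Petri net): $S$, $\Sigma$ are disjoint finite sets of places and transitions, $F\subseteq (S\times\Sigma)\cup(\Sigma\times S)$, $m_0\subseteq S$; write ${}^\bullet a$, $a^\bullet$ for the pre- and postset of $a\in\Sigma$. For $m,m'\subseteq S$ put $m\xrightarrow{a}m'$ if ${}^\bullet a\subseteq m$, $(a^\bullet\setminus{}^\bullet a)\cap m=\varnothing$ and $m'=(m\setminus{}^\bullet a)\cup a^\bullet$; extend this to words. Let $(a,b)\in I$ iff $a\neq b$ and $({}^\bullet a\cup a^\bullet)\cap({}^\bullet b\cup b^\bullet)=\varnothing$, and let $\langle\sigma\rangle$ be the Mazurkiewicz trace of $\sigma\in\Sigma^*$ over $(\Sigma,I)$, with prefix order $\sqsubseteq$. A firing trace is the trace of a word that can fire at $m_0$; a trace is prime if its words are non-empty and all have the same last letter. The event structure unfolding $\mathcal E_N$ is the $\Sigma$-labeled event structure whose events are the prime firing traces, ordered by $\sqsubseteq$, two events being in conflict iff no firing trace has both as prefixes, and each event being labeled by its last letter. Let $X_N$ be the directed labeled square complex whose 1-skeleton is the connected component of $m_0$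 in the graph of all markings with the arcs $m\xrightarrow{a}m'$ as edges (directed from $m$ to $m'$, labeled $a$; loops and parallel edges allowed), and whose squares are given by the arcs $m\xrightarrow{a}m_1\xrightarrow{b}m'$, $m\xrightarrow{b}m_2\xrightarrow{a}m'$ with $(a,b)\in I$. Let $\varphi:\widetilde X_N\to X_N$ be a universal cover (a simply connected covering, with lifted directions and labels), let $\widetilde m_0$ be any lift of $m_0$, and let $\mathcal F(\widetilde m_0)$ be the principal filter of $\widetilde m_0$, that is, the set of vertices reachable from $\widetilde m_0$ by directed paths, ordered by directed reachability and with the labeled directed edges of $\widetilde X_N$. Then there is a $\Sigma$-labeled event structure $\mathcal E_{X_N}$ whose domain (the set of its configurations ordered by inclusion, with each Hasse edge $(c,c\cup\{e\})$ labeled by the label of $e$) is isomorphic to $\mathcal F(\widetilde m_0)$, and for every such $\mathcal E_{X_N}$ the labeled event structures $\mathcal E_N$ and $\mathcal E_{X_N}$ are isomorphic. More precisely, call a word geodesic for a configuration $c$ of $\mathcal E_{X_N}$ if it is the word of labels of a shortest path from $\varnothing$ to $c$ in the undirected Hasse diagram of the domain, and call the traces of such words geodesic traces. Then the geodesic traces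 of $\mathcal E_{X_N}$ are exactly the firing traces of $N$; there is a bijection $c\mapsto g(c)$ from the configurations of $\mathcal E_{X_N}$ to the firing traces of $N$ such that a word is geodesic for $c$ iff its trace is $g(c)$; and the isomorphism $f:\mathcal E_N\to\mathcal E_{X_N}$ can be chosen such that $g(\downarrow f(e))=e$ for every event $e$ of $\mathcal E_N$, where $\downarrow e'$ denotes the set of events $\le e'$. -/

import Mathlib

universe u v w x u₂ v₂

/-! ### Labeled event structures, their configurations and domains -/

/-- A `Λ`-labeled event structure `(E, ≤, #, λ)`. -/
structure LabeledEventStructure (Λ : Type v) where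
  Event : Type u
  le : Event → Event → Prop
  conflict : Event → Event → Prop
  label : Event → Λ
  le_refl : ∀ e, le e e
  le_trans : ∀ e e' e'', le e e' → le e' e'' → le e e''
  le_antisymm : ∀ e e', le e e' → le e' e → e = e'
  conflict_irrefl : ∀ e, ¬ conflict e e
  conflict_symm : ∀ e e', conflict e e' → conflict e' e
  finite_below : ∀ e, {e' | le e' e}.Finite
  conflict_of_le : ∀ e e' e'', conflict e e' → le e' e'' → conflict e e''

namespace LabeledEventStructure

/-- An isomorphism of labeled event structures. -/
structure Iso {Λ : Type v} (E₁ : LabeledEventStructure.{u} Λ) (E₂ : LabeledEventStructure.{w} Λ)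
    where
  toEquiv : E₁.Event ≃ E₂.Event
  le_iff : ∀ e e', E₁.le e e' ↔ E₂.le (toEquiv e) (toEquiv e')
  conflict_iff : ∀ e e', E₁.conflict e e' ↔ E₂.conflict (toEquiv e) (toEquiv e')
  label_eq : ∀ e, E₂.label (toEquiv e) = E₁.label e

/-- A configuration: a finite, conflict-free, downward-closed set of events. -/
structure Config {Λ : Type v} (E : LabeledEventStructure.{u} Λ) where
  carrier : Set E.Event
  finite : carrier.Finite
  conflictFree : ∀ e ∈ carrier, ∀ e' ∈ carrier, ¬ E.conflict e e'
  downClosed : ∀ e ∈ carrier, ∀ e', E.le e' e → e' ∈ carrier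

variable {Λ : Type v} (E : LabeledEventStructure.{u} Λ)

/-- The empty configuration. -/
def emptyConfig : E.Config where
  carrier := ∅
  finite := Set.finite_empty
  conflictFree := by simp
  downClosed := by simp

/-- The configuration `↓e`. -/
def below (e : E.Event) : E.Config where
  carrier := {e' | E.le e' e}
  finite := E.finite_below e
  conflictFree := fun a ha b hb hab =>
    E.conflict_irrefl e <|
      E.conflict_of_le e a e
        (E.conflict_symm a e (E.conflict_of_le a b e hab hb)) ha
  downClosed := fun a ha b hb => E.le_trans b a e hb ha

/-- `(c, c')` is a directed edge, labeled `a`, of the Hasse diagram of the domain: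
`c' = c ∪ {e}` for an event `e ∉ c` with label `a`. -/
def HasseEdge (c : E.Config) (a : Λ) (c' : E.Config) : Prop :=
  ∃ e, e ∉ c.carrier ∧ c'.carrier = insert e c.carrier ∧ E.label e = a

/-- `σ` is the word of labels of a path from `c` to `c'` in the (undirected) covering graph
`G(E)` of the domain. -/
def PathWord : E.Config → List Λ → E.Config → Prop
  | c, [], c' => c = c'
  | c, a :: σ, c' => ∃ d, (E.HasseEdge c a d ∨ E.HasseEdge d a c) ∧ PathWord d σ c'

/-- `σ` is the word of labels of a shortest path of `G(E)` from `∅` to `c`. -/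
def IsGeodesicWord (c : E.Config) (σ : List Λ) : Prop :=
  E.PathWord E.emptyConfig σ c ∧ ∀ τ, E.PathWord E.emptyConfig τ c → σ.length ≤ τ.length

end LabeledEventStructure

/-! ### Mazurkiewicz traces -/

/-- An independence relation on an alphabet. -/
structure TraceAlphabet (A : Type v) where
  indep : A → A → Prop
  irrefl : ∀ a, ¬ indep a a
  symm : ∀ a b, indep a b → indep b a

namespace TraceAlphabet

variable {A : Type v} (M : TraceAlphabet A)

/-- `σ a b σ' ↔ σ b a σ'` for independent letters `a`, `b`. -/
def Swap (x y : List A) : Prop :=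
  ∃ (σ σ' : List A) (a b : A), M.indep a b ∧
    x = σ ++ a :: b :: σ' ∧ y = σ ++ b :: a :: σ'

/-- The equivalence relation `∼_I`: the reflexive and transitive closure of `Swap`. -/
def wordSetoid : Setoid (List A) where
  r := Relation.ReflTransGen M.Swap
  iseqv :=
    { refl := fun _ => Relation.ReflTransGen.refl
      symm := fun h => by
        induction h with
        | refl => exact Relation.ReflTransGen.refl
        | tail _ h ih =>
          obtain ⟨σ, σ', a, b, hab, h₁, h₂⟩ := h
          exact Relation.ReflTransGen.head ⟨σ, σ', b, a, M.symm a b hab, h₂, h₁⟩ ih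
      trans := fun h₁ h₂ => h₁.trans h₂ }

/-- Mazurkiewicz traces. -/
def Trace : Type v := Quotient M.wordSetoid

/-- The trace `⟨σ⟩` of a word. -/
def trace (σ : List A) : M.Trace := Quotient.mk M.wordSetoid σ

/-- The prefix relation `⊑` on traces. -/
def Prefix (s t : M.Trace) : Prop :=
  ∃ σ τ : List A, M.trace σ = s ∧ M.trace τ = t ∧ σ <+: τ

/-- A trace is prime if its words are non-null and all have the same last letter. -/
def IsPrime (t : M.Trace) : Prop :=
  ∃ a, ∀ σ, M.trace σ = t → σ.getLast? = some a

theorem trace_eq_iff {σ τ : List A} : M.trace σ = M.trace τ ↔ Relation.ReflTransGen M.Swap σ τ :=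
  ⟨fun h => Quotient.exact h, fun h => Quotient.sound h⟩

theorem length_eq {σ τ : List A} (h : Relation.ReflTransGen M.Swap σ τ) :
    σ.length = τ.length := by
  induction h with
  | refl => rfl
  | tail _ h ih =>
    obtain ⟨σ, σ', a, b, _, h₁, h₂⟩ := h
    rw [ih, h₁, h₂]; simp

theorem append_right {σ τ : List A} (h : Relation.ReflTransGen M.Swap σ τ) (ρ : List A) :
    Relation.ReflTransGen M.Swap (σ ++ ρ) (τ ++ ρ) := by
  induction h with
  | refl => exact Relation.ReflTransGen.refl
  | tail _ h ih =>
    obtain ⟨α, β, a, b, hab, h₁, h₂⟩ := h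
    exact ih.tail ⟨α, β ++ ρ, a, b, hab, by simp [h₁], by simp [h₂]⟩

theorem prefix_iff {σ τ : List A} :
    M.Prefix (M.trace σ) (M.trace τ) ↔ ∃ ρ, M.trace (σ ++ ρ) = M.trace τ := by
  constructor
  · rintro ⟨σ', τ', h₁, h₂, ρ, rfl⟩
    refine ⟨ρ, ?_⟩
    rw [← h₂]
    exact (M.trace_eq_iff.2 (M.append_right (M.trace_eq_iff.1 h₁) ρ)).symm
  · rintro ⟨ρ, h⟩
    exact ⟨σ, σ ++ ρ, rfl, h, ρ, rfl⟩

theorem exists_trace (t : M.Trace) : ∃ σ, M.trace σ = t := Quotient.exists_rep t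

theorem prefix_refl (t : M.Trace) : M.Prefix t t := by
  obtain ⟨σ, rfl⟩ := M.exists_trace t
  exact ⟨σ, σ, rfl, rfl, List.prefix_refl σ⟩

theorem prefix_trans {r s t : M.Trace} (h : M.Prefix r s) (h' : M.Prefix s t) :
    M.Prefix r t := by
  obtain ⟨ρ, rfl⟩ := M.exists_trace r
  obtain ⟨σ, rfl⟩ := M.exists_trace s
  obtain ⟨τ, rfl⟩ := M.exists_trace t
  obtain ⟨α, hα⟩ := M.prefix_iff.1 h
  obtain ⟨β, hβ⟩ := M.prefix_iff.1 h'
  refine M.prefix_iff.2 ⟨α ++ β, ?_⟩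
  rw [← hβ, ← List.append_assoc]
  exact M.trace_eq_iff.2 (M.append_right (M.trace_eq_iff.1 hα) β)

theorem prefix_antisymm {s t : M.Trace} (h : M.Prefix s t) (h' : M.Prefix t s) : s = t := by
  obtain ⟨σ, rfl⟩ := M.exists_trace s
  obtain ⟨τ, rfl⟩ := M.exists_trace t
  obtain ⟨α, hα⟩ := M.prefix_iff.1 h
  obtain ⟨β, hβ⟩ := M.prefix_iff.1 h'
  have h₁ := M.length_eq (M.trace_eq_iff.1 hα)
  have h₂ := M.length_eq (M.trace_eq_iff.1 hβ)
  simp only [List.length_append] at h₁ h₂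
  have : α = [] := List.length_eq_zero_iff.1 (by omega)
  subst this
  simpa using hα

theorem finite_prefix [Finite A] (t : M.Trace) : {s | M.Prefix s t}.Finite := by
  obtain ⟨τ, rfl⟩ := M.exists_trace t
  refine ((List.finite_length_le A τ.length).image M.trace).subset ?_
  rintro s hs
  obtain ⟨σ, rfl⟩ := M.exists_trace s
  obtain ⟨ρ, hρ⟩ := M.prefix_iff.1 hs
  have h₁ := M.length_eq (M.trace_eq_iff.1 hρ)
  simp only [List.length_append] at h₁
  exact ⟨σ, by change σ.length ≤ τ.length; omega, rfl⟩

end TraceAlphabet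

/-- The set of geodesic traces of a labeled event structure over a trace alphabet. -/
def LabeledEventStructure.geodesicTraces {A : Type v} (E : LabeledEventStructure.{u} A)
    (M : TraceAlphabet A) : Set M.Trace :=
  {t | ∃ c σ, E.IsGeodesicWord c σ ∧ M.trace σ = t}

/-! ### Net systems and their event structure unfoldings -/

/-- A net system with places `S` and transitions `T`: a flow relation
`F ⊆ (S × T) ∪ (T × S)` and an initial marking. -/
structure NetSystem (S : Type u) (T : Type v) where
  flow : Set (S × T ⊕ T × S)
  initial : Set S

namespace NetSystem

variable {S : Type u} {T : Type v} (N : NetSystem S T)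

/-- The preset of a transition. -/
def pre (a : T) : Set S := {s | Sum.inl (s, a) ∈ N.flow}

/-- The postset of a transition. -/
def post (a : T) : Set S := {s | Sum.inr (a, s) ∈ N.flow}

/-- The firing rule `m --a--> m'`. -/
def Fires (m : Set S) (a : T) (m' : Set S) : Prop :=
  N.pre a ⊆ m ∧ (N.post a \ N.pre a) ∩ m = ∅ ∧ m' = (m \ N.pre a) ∪ N.post a

/-- The firing rule `m --σ--> m'` for words. -/
def FiresWord : Set S → List T → Set S → Prop
  | m, [], m' => m = m'
  | m, a :: σ, m' => ∃ m₁, N.Fires m a m₁ ∧ FiresWord m₁ σ m'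

/-- The trace alphabet of a net system: two distinct transitions are independent if the sets
of places around them are disjoint. -/
def alphabet : TraceAlphabet T where
  indep a b := a ≠ b ∧ (N.pre a ∪ N.post a) ∩ (N.pre b ∪ N.post b) = ∅
  irrefl := fun _ h => h.1 rfl
  symm := fun _ _ h => ⟨h.1.symm, by rw [Set.inter_comm]; exact h.2⟩

/-- The set of firing traces: traces of firing sequences at the initial marking. -/
def firingTraces : Set N.alphabet.Trace :=
  {t | ∃ σ m, N.FiresWord N.initial σ m ∧ N.alphabet.trace σ = t}

/-- The event structure unfolding of a net system. -/
noncomputable def unfolding [Finite T] : LabeledEventStructure.{v} T where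
  Event := {t : N.alphabet.Trace // t ∈ N.firingTraces ∧ N.alphabet.IsPrime t}
  le e e' := N.alphabet.Prefix e.1 e'.1
  conflict e e' :=
    ¬ ∃ t ∈ N.firingTraces, N.alphabet.Prefix e.1 t ∧ N.alphabet.Prefix e'.1 t
  label e := e.2.2.choose
  le_refl e := N.alphabet.prefix_refl e.1
  le_trans _ _ _ h h' := N.alphabet.prefix_trans h h'
  le_antisymm _ _ h h' := Subtype.ext (N.alphabet.prefix_antisymm h h')
  conflict_irrefl e h :=
    h ⟨e.1, e.2.1, N.alphabet.prefix_refl e.1, N.alphabet.prefix_refl e.1⟩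
  conflict_symm _ _ h := fun ⟨t, ht, h₁, h₂⟩ => h ⟨t, ht, h₂, h₁⟩
  finite_below e :=
    Set.Finite.preimage (f := Subtype.val) (s := {s | N.alphabet.Prefix s e.1})
      Subtype.val_injective.injOn (N.alphabet.finite_prefix e.1)
  conflict_of_le _ _ _ h hle := fun ⟨t, ht, h₁, h₂⟩ =>
    h ⟨t, ht, h₁, N.alphabet.prefix_trans hle h₂⟩

end NetSystem

/-! ### Directed labeled square complexes, coverings, universal covers -/

/-- A 2-dimensional cube complex with an admissible orientation and a coloring of the edges.
Edges may be loops and may be parallel. `IsSquare e f e' f'` says that there is a square with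
opposite edges `e`, `e'` and `f`, `f'` whose boundary consists of the directed paths `e f'`
and `f e'` from its source to its sink; the two ways to list the boundary of one square are
exchanged by `square_swap`. A square is determined by its boundary. -/
structure DirectedSquareComplex (Λ : Type w) where
  Vertex : Type u
  Edge : Type v
  source : Edge → Vertex
  target : Edge → Vertex
  label : Edge → Λ
  IsSquare : Edge → Edge → Edge → Edge → Prop
  square_source : ∀ e f e' f', IsSquare e f e' f' → source e = source f
  square_side : ∀ e f e' f', IsSquare e f e' f' → target e = source f'
  square_sink : ∀ e f e' f', IsSquare e f e' f' → target e' = target f'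
  square_swap : ∀ e f e' f', IsSquare e f e' f' → IsSquare f e f' e'

namespace DirectedSquareComplex

variable {Λ : Type w}

section
variable (X : DirectedSquareComplex.{u, v} Λ)

/-- A step of an edge path: an edge with a direction of traversal (`true` is forward). -/
def stepSource (s : X.Edge × Bool) : X.Vertex := if s.2 then X.source s.1 else X.target s.1

/-- The end of a step. -/
def stepTarget (s : X.Edge × Bool) : X.Vertex := if s.2 then X.target s.1 else X.source s.1

/-- `l` is an edge path of the 1-skeleton from `x` to `y`. -/
def IsPath : X.Vertex → List (X.Edge × Bool) → X.Vertex → Prop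
  | x, [], y => x = y
  | x, s :: l, y => X.stepSource s = x ∧ IsPath (X.stepTarget s) l y

/-- An elementary homotopy: insert a backtrack, or replace one side of a square by the
other. -/
def ElementaryHomotopy (l l' : List (X.Edge × Bool)) : Prop :=
  (∃ p q s, l = p ++ q ∧ l' = p ++ s :: (s.1, !s.2) :: q) ∨
  (∃ p q e f e' f', X.IsSquare e f e' f' ∧
    l = p ++ (e, true) :: (f', true) :: q ∧ l' = p ++ (f, true) :: (e', true) :: q)

/-- Homotopy of edge paths from `x` to `y`. -/
def Homotopic (x y : X.Vertex) : List (X.Edge × Bool) → List (X.Edge × Bool) → Prop :=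
  Relation.EqvGen fun l l' => X.IsPath x l y ∧ X.IsPath x l' y ∧ X.ElementaryHomotopy l l'

/-- The complex is connected and every closed edge path is null-homotopic. -/
def SimplyConnected : Prop :=
  Nonempty X.Vertex ∧ (∀ x y, ∃ l, X.IsPath x l y) ∧
    ∀ x l, X.IsPath x l x → X.Homotopic x x l []

/-- The order `≺_o` on vertices: there is a directed path from `x` to `y`. -/
def DirReach : X.Vertex → X.Vertex → Prop :=
  Relation.ReflTransGen fun x y => ∃ e, X.source e = x ∧ X.target e = y

/-- The principal filter of a vertex. -/
def filter (x : X.Vertex) : Type u := {y : X.Vertex // X.DirReach x y}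

end

/-- Maps of complexes: cubes go to cubes of the same dimension, and inclusions of cubes,
directions and colors of edges are preserved. -/
structure Hom (Y : DirectedSquareComplex.{u, v} Λ) (X : DirectedSquareComplex.{u₂, v₂} Λ) where
  onVertex : Y.Vertex → X.Vertex
  onEdge : Y.Edge → X.Edge
  source_onEdge : ∀ e, X.source (onEdge e) = onVertex (Y.source e)
  target_onEdge : ∀ e, X.target (onEdge e) = onVertex (Y.target e)
  label_onEdge : ∀ e, X.label (onEdge e) = Y.label e
  square_onEdge : ∀ e f e' f', Y.IsSquare e f e' f' →
    X.IsSquare (onEdge e) (onEdge f) (onEdge e') (onEdge f')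

/-- A covering map: a surjection that induces a bijection from the star of every vertex `y`
to the star of its image, that is, a bijection of the outgoing edges, of the incoming edges,
and of the squares having a corner at the vertex (which is their source, their sink, or one
of the two other corners, which are exchanged by `square_swap`). For squares, injectivity
follows from the bijections on edges, so only the existence of lifts is listed. -/
structure Hom.IsCovering {Y : DirectedSquareComplex.{u, v} Λ}
    {X : DirectedSquareComplex.{u₂, v₂} Λ} (φ : Hom Y X) : Prop where
  surjective : Function.Surjective φ.onVertex
  outgoing : ∀ y, Set.BijOn φ.onEdge {e | Y.source e = y} {e | X.source e = φ.onVertex y}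
  incoming : ∀ y, Set.BijOn φ.onEdge {e | Y.target e = y} {e | X.target e = φ.onVertex y}
  square_at_source : ∀ y e f e' f', X.IsSquare e f e' f' → X.source e = φ.onVertex y →
    ∃ d g d' g', Y.IsSquare d g d' g' ∧ Y.source d = y ∧
      φ.onEdge d = e ∧ φ.onEdge g = f ∧ φ.onEdge d' = e' ∧ φ.onEdge g' = f'
  square_at_side : ∀ y e f e' f', X.IsSquare e f e' f' → X.target e = φ.onVertex y →
    ∃ d g d' g', Y.IsSquare d g d' g' ∧ Y.target d = y ∧
      φ.onEdge d = e ∧ φ.onEdge g = f ∧ φ.onEdge d' = e' ∧ φ.onEdge g' = f'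
  square_at_sink : ∀ y e f e' f', X.IsSquare e f e' f' → X.target e' = φ.onVertex y →
    ∃ d g d' g', Y.IsSquare d g d' g' ∧ Y.target d' = y ∧
      φ.onEdge d = e ∧ φ.onEdge g = f ∧ φ.onEdge d' = e' ∧ φ.onEdge g' = f'

/-- A universal cover: a simply connected covering space. -/
def Hom.IsUniversalCover {Y : DirectedSquareComplex.{u, v} Λ}
    {X : DirectedSquareComplex.{u₂, v₂} Λ} (φ : Hom Y X) : Prop :=
  φ.IsCovering ∧ Y.SimplyConnected

end DirectedSquareComplex

/-- The domain of the labeled event structure `E` is the principal filter of `y` in `Y`: there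
is a bijection `θ` from the configurations of `E` to the filter that is an isomorphism both of
the ordered sets and of the directed graphs with labeled edges. -/
def LabeledEventStructure.HasDomain {Λ : Type w} (E : LabeledEventStructure.{x} Λ)
    (Y : DirectedSquareComplex.{u, v} Λ) (y : Y.Vertex) : Prop :=
  ∃ θ : E.Config ≃ Y.filter y,
    (∀ c c', c.carrier ⊆ c'.carrier ↔ Y.DirReach (θ c).1 (θ c').1) ∧
    (∀ c a c', E.HasseEdge c a c' ↔
      ∃ ε, Y.source ε = (θ c).1 ∧ Y.target ε = (θ c').1 ∧ Y.label ε = a)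

/-! ### The complex of a net system -/

namespace NetSystem

variable {S : Type u} {T : Type v} (N : NetSystem S T)

/-- The vertices of the marking graph: the connected component of the initial marking in the
support of the graph of all markings. -/
def Marking : Type u :=
  {m : Set S // Relation.EqvGen (fun m m' => ∃ a, N.Fires m a m') N.initial m}

/-- The initial marking as a vertex of the marking graph. -/
def initialMarking : N.Marking := ⟨N.initial, Relation.EqvGen.refl _⟩

/-- An edge of the directed marking graph: an arc `m --a--> m'`. -/
structure Arc where
  source : N.Marking
  action : T
  target : N.Marking
  fires : N.Fires source.1 action target.1

/-- The directed labeled complex `X_N`: its 1-skeleton is the directed marking graph, and its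
squares are spanned by `m --a--> m₁ --b--> m'` and `m --b--> m₂ --a--> m'` with `a`, `b`
independent. -/
def complex : DirectedSquareComplex T where
  Vertex := N.Marking
  Edge := N.Arc
  source := Arc.source
  target := Arc.target
  label := Arc.action
  IsSquare e f e' f' :=
    N.alphabet.indep e.action f.action ∧ e'.action = e.action ∧ f'.action = f.action ∧
      e.source = f.source ∧ e.target = f'.source ∧ f.target = e'.source ∧ e'.target = f'.target
  square_source := fun _ _ _ _ h => h.2.2.2.1
  square_side := fun _ _ _ _ h => h.2.2.2.2.1
  square_sink := fun _ _ _ _ h => h.2.2.2.2.2.2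
  square_swap := fun _ _ _ _ ⟨h₁, h₂, h₃, h₄, h₅, h₆, h₇⟩ =>
    ⟨N.alphabet.symm _ _ h₁, h₃, h₂, h₄.symm, h₆, h₅, h₇.symm⟩

end NetSystem

/-! Everything is compared with one labeled poset: the firing traces under `⊑`, with an edge labeled
`a` from `s` to `sa` (`IsTraceDomain`). The filter in the cover and the domain of the unfolding are
both isomorphic to it, and the events of any event structure with this domain can be read off from
it.

The filter (`exists_filter_equiv`). Directed paths from the base vertex are the unique lifts of
firing sequences. Since squares lift, equivalent words lead to the same vertex
(`dirPath_of_trace_eq`). Conversely, two directed paths with common ends bound a null-homotopic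
loop. Fix dependent letters `a`, `b`, map labels to a free group and kill all other letters: the
holonomy around every square is trivial, so both words have the same projection to `a`, `b`
(`SimplyConnected.trace_eq`). These projections determine a trace (`prefix_of_proj`).

The unfolding. A firing trace is sent to the set of its prime prefixes. This reflects the order
(`prefix_of_primes`), and appending a letter adds exactly one prime (`exists_prime_new`,
`IsPrimeWord.eq_of_new`). Every configuration arises, by induction on the number of events
(`primeConfig_surjective`); firing is needed here only to see that an enabled transition survives
independent ones.

Recovering events. A path from `∅` to `c` has length at least `|c|`, with equality only if it always
ascends; so geodesic words of `c` are the words of one trace (`isGeodesicWord_iff`). The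
configurations `↓e` are those with a single maximal event, which correspond to prime traces
(`isPrimeWord_below`, `exists_below_of_isPrimeWord`); order and conflict follow from membership in
configurations. -/

/-! ### Concatenation and commutation of traces -/

namespace TraceAlphabet

variable {A : Type v} (M : TraceAlphabet A)

theorem append_left {σ τ : List A} (h : Relation.ReflTransGen M.Swap σ τ) (ρ : List A) :
    Relation.ReflTransGen M.Swap (ρ ++ σ) (ρ ++ τ) := by
  induction h with
  | refl => exact Relation.ReflTransGen.refl
  | tail _ h ih =>
    obtain ⟨α, β, a, b, hab, h₁, h₂⟩ := h
    exact ih.tail ⟨ρ ++ α, β, a, b, hab, by simp [h₁], by simp [h₂]⟩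

theorem trace_append_congr {σ σ' τ τ' : List A} (h : M.trace σ = M.trace σ')
    (h' : M.trace τ = M.trace τ') : M.trace (σ ++ τ) = M.trace (σ' ++ τ') :=
  M.trace_eq_iff.2 ((M.append_right (M.trace_eq_iff.1 h) τ).trans
    (M.append_left (M.trace_eq_iff.1 h') σ'))

theorem trace_length_eq {σ τ : List A} (h : M.trace σ = M.trace τ) : σ.length = τ.length :=
  M.length_eq (M.trace_eq_iff.1 h)

theorem trace_swap {a b : A} (h : M.indep a b) : M.trace [a, b] = M.trace [b, a] :=
  M.trace_eq_iff.2 (.single ⟨[], [], a, b, h, rfl, rfl⟩)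

theorem trace_cons_of_indep {a : A} {u : List A} (h : ∀ x ∈ u, M.indep a x) :
    M.trace (a :: u) = M.trace (u ++ [a]) := by
  induction u with
  | nil => rfl
  | cons x u ih =>
    have h₁ : M.trace ([a, x] ++ u) = M.trace ([x, a] ++ u) :=
      M.trace_append_congr (M.trace_swap (h x (by simp))) rfl
    have h₂ : M.trace ([x] ++ a :: u) = M.trace ([x] ++ (u ++ [a])) :=
      M.trace_append_congr rfl (ih fun y hy => h y (by simp [hy]))
    exact h₁.trans h₂

/-! ### Projections to pairs of letters -/

open Classical in
/-- The projection of a word to the letters `a` and `b`. -/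
noncomputable def proj (a b : A) (σ : List A) : List A := σ.filter fun x => x = a ∨ x = b

theorem proj_append (a b : A) (σ τ : List A) : proj a b (σ ++ τ) = proj a b σ ++ proj a b τ :=
  List.filter_append ..

theorem proj_cons (a b x : A) (σ : List A) : proj a b (x :: σ) = proj a b [x] ++ proj a b σ :=
  proj_append a b [x] σ

theorem proj_singleton_of_mem {a b x : A} (h : x = a ∨ x = b) : proj a b [x] = [x] := by
  simp [proj, h]

theorem proj_singleton_of_not_mem {a b x : A} (h : ¬(x = a ∨ x = b)) : proj a b [x] = [] := by
  simpa [proj] using h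

theorem proj_eq_nil {a b : A} {σ : List A} (h : ∀ x ∈ σ, ¬(x = a ∨ x = b)) :
    proj a b σ = [] := by
  simpa [proj] using h

theorem mem_proj {a b x : A} {σ : List A} : x ∈ proj a b σ ↔ x ∈ σ ∧ (x = a ∨ x = b) := by
  simp [proj]

/-- A swap exchanges two independent letters, and a projection to a dependent pair retains at most
one of them. -/
theorem proj_eq_of_trace_eq {σ τ : List A} (h : M.trace σ = M.trace τ) {a b : A}
    (hab : ¬ M.indep a b) : proj a b σ = proj a b τ := by
  replace h := M.trace_eq_iff.1 h
  induction h with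
  | refl => rfl
  | tail _ h ih =>
    obtain ⟨α, β, x, y, hxy, rfl, rfl⟩ := h
    rw [ih, proj_append, proj_append, proj_cons a b x (y :: β), proj_cons a b y β,
      proj_cons a b y (x :: β), proj_cons a b x β, ← List.append_assoc (proj a b [x]),
      ← List.append_assoc (proj a b [y])]
    congr 2
    by_cases hx : x = a ∨ x = b
    · by_cases hy : y = a ∨ y = b
      · exfalso
        rcases hx with rfl | rfl <;> rcases hy with rfl | rfl
        · exact M.irrefl _ hxy
        · exact hab hxy
        · exact hab (M.symm _ _ hxy)
        · exact M.irrefl _ hxy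
      · simp [proj_singleton_of_not_mem hy]
    · simp [proj_singleton_of_not_mem hx]

theorem exists_first {a : A} {τ : List A} (h : a ∈ τ) : ∃ u v, τ = u ++ a :: v ∧ a ∉ u := by
  classical
  induction τ with
  | nil => simp at h
  | cons x τ ih =>
    by_cases hx : x = a
    · exact ⟨[], τ, by simp [hx], by simp⟩
    · obtain ⟨u, v, rfl, hu⟩ := ih (by simpa [Ne.symm hx] using h)
      exact ⟨x :: u, v, rfl, by simp [hu, Ne.symm hx]⟩

/-- The prefix relation on traces is determined by the projections to dependent pairs. -/
theorem prefix_of_proj {σ τ : List A}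
    (h : ∀ a b, ¬ M.indep a b → proj a b σ <+: proj a b τ) :
    M.Prefix (M.trace σ) (M.trace τ) := by
  induction σ generalizing τ with
  | nil => exact M.prefix_iff.2 ⟨τ, rfl⟩
  | cons a σ ih =>
    have hself : ∀ b, proj a b (a :: σ) = a :: proj a b σ := fun b => by
      rw [proj_cons, proj_singleton_of_mem (Or.inl rfl)]; rfl
    -- The pair `(a, a)` is dependent by irreflexivity; its projection counts the occurrences of
    -- `a`.
    have ha : a ∈ τ := by
      have h₁ := (h a a (M.irrefl a)).subset (a := a) (by simp [hself])
      exact (mem_proj.1 h₁).1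
    obtain ⟨u, v, rfl, hu⟩ := exists_first ha
    -- If `x` in `u` depended on `a`, the projection of `τ` to `a`, `x` would begin inside `u`,
    -- hence not with `a`.
    have hind : ∀ x ∈ u, M.indep a x := by
      intro x hx
      by_contra hax
      have h₁ := h a x hax
      rw [hself, proj_append] at h₁
      have hx' : x ∈ proj a x u := mem_proj.2 ⟨hx, Or.inr rfl⟩
      cases hp : proj a x u with
      | nil => simp [hp] at hx'
      | cons z w =>
        rw [hp, List.cons_append, List.cons_prefix_cons] at h₁
        have : z ∈ proj a x u := by simp [hp]
        exact hu (h₁.1 ▸ (mem_proj.1 this).1)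
    have htr : M.trace (u ++ a :: v) = M.trace (a :: (u ++ v)) := by
      have := M.trace_append_congr (M.trace_cons_of_indep hind).symm (rfl : M.trace v = M.trace v)
      simpa using this
    have hpre : M.Prefix (M.trace σ) (M.trace (u ++ v)) := by
      refine ih fun b c hbc => ?_
      have h₁ := h b c hbc
      rwa [M.proj_eq_of_trace_eq htr hbc, proj_cons, proj_cons b c a (u ++ v),
        List.prefix_append_right_inj] at h₁
    obtain ⟨ρ, hρ⟩ := M.prefix_iff.1 hpre
    rw [htr]
    exact M.prefix_iff.2 ⟨ρ, M.trace_append_congr (rfl : M.trace [a] = _) hρ⟩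

theorem proj_prefix {σ τ : List A} (h : M.Prefix (M.trace σ) (M.trace τ)) {a b : A}
    (hab : ¬ M.indep a b) : proj a b σ <+: proj a b τ := by
  obtain ⟨ρ, hρ⟩ := M.prefix_iff.1 h
  rw [← M.proj_eq_of_trace_eq hρ hab, proj_append]
  exact List.prefix_append _ _

theorem trace_eq_of_proj {σ τ : List A}
    (h : ∀ a b, ¬ M.indep a b → proj a b σ = proj a b τ) : M.trace σ = M.trace τ :=
  M.prefix_antisymm (M.prefix_of_proj fun a b hab => by rw [h a b hab])
    (M.prefix_of_proj fun a b hab => by rw [h a b hab])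

/-- Words are cancellative, and so are all projections to dependent pairs. -/
theorem trace_cancel_right {σ τ ρ : List A} (h : M.trace (σ ++ ρ) = M.trace (τ ++ ρ)) :
    M.trace σ = M.trace τ :=
  M.trace_eq_of_proj fun a b hab => by
    have := M.proj_eq_of_trace_eq h hab
    rwa [proj_append, proj_append, List.append_left_inj] at this

/-! ### Prefixes and prime traces -/

theorem prefix_append (σ ρ : List A) : M.Prefix (M.trace σ) (M.trace (σ ++ ρ)) :=
  M.prefix_iff.2 ⟨ρ, rfl⟩

theorem prefix_length {σ τ : List A} (h : M.Prefix (M.trace σ) (M.trace τ)) :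
    σ.length ≤ τ.length := by
  obtain ⟨ρ, hρ⟩ := M.prefix_iff.1 h
  simp [← M.trace_length_eq hρ]

/-- A word whose trace ends with the letter `a` has a last occurrence of `a` which can be moved
to the end. -/
theorem exists_last_occurrence {σ τ : List A} {a : A} (h : M.trace σ = M.trace (τ ++ [a])) :
    ∃ u v, σ = u ++ a :: v ∧ (∀ x ∈ v, M.indep a x) ∧ M.trace (u ++ v) = M.trace τ := by
  have ha : a ∈ σ := by
    have h₁ := M.proj_eq_of_trace_eq h (M.irrefl a)
    rw [proj_append, proj_singleton_of_mem (Or.inl rfl)] at h₁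
    have : a ∈ proj a a σ := by simp [h₁]
    exact (mem_proj.1 this).1
  -- The last occurrence of `a` is the first one in the reversed word.
  obtain ⟨v, u, hσ, hv⟩ := exists_first (List.mem_reverse.2 ha)
  have hσ : σ = u.reverse ++ a :: v.reverse := by
    rw [← List.reverse_reverse σ, hσ]; simp
  have hind : ∀ x ∈ v.reverse, M.indep a x := by
    intro x hx
    by_contra hax
    have h₁ := M.proj_eq_of_trace_eq h hax
    have hne : proj a x v.reverse ≠ [] :=
      List.ne_nil_of_mem (mem_proj.2 ⟨hx, Or.inr rfl⟩)
    rw [hσ, proj_append, proj_append, proj_cons, proj_singleton_of_mem (Or.inl rfl),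
      ← List.append_assoc] at h₁
    have h₂ := congrArg List.getLast? h₁
    rw [List.getLast?_append_of_ne_nil _ hne, List.getLast?_concat] at h₂
    have h₃ := (mem_proj.1 (List.mem_of_getLast? h₂)).1
    exact hv (List.mem_reverse.1 h₃)
  refine ⟨u.reverse, v.reverse, hσ, hind, ?_⟩
  have h₁ := M.trace_append_congr (rfl : M.trace u.reverse = _) (M.trace_cons_of_indep hind)
  refine M.trace_cancel_right (ρ := [a]) ?_
  rw [← h, hσ, List.append_assoc]
  exact h₁.symm

/-- A prefix of `τ a` either is a prefix of `τ` or contains the last `a`. -/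
theorem prefix_concat_cases {σ τ ρ : List A} {a : A}
    (h : M.trace (σ ++ ρ) = M.trace (τ ++ [a])) :
    M.Prefix (M.trace σ) (M.trace τ) ∨
      (∀ x ∈ ρ, M.indep a x) ∧
        ∃ σ', M.trace σ = M.trace (σ' ++ [a]) ∧ M.trace (σ' ++ ρ) = M.trace τ := by
  obtain ⟨u, v, huv, hv, htr⟩ := M.exists_last_occurrence h
  rcases List.append_eq_append_iff.1 huv with ⟨w, rfl, rfl⟩ | ⟨w, rfl, hw⟩
  · exact Or.inl (M.prefix_iff.2 ⟨w ++ v, by simpa using htr⟩)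
  · cases w with
    | nil =>
      simp only [List.nil_append] at hw
      subst hw
      exact Or.inl (M.prefix_iff.2 ⟨v, by simpa using htr⟩)
    | cons x w =>
      obtain ⟨rfl, rfl⟩ : a = x ∧ v = w ++ ρ := by simpa using hw
      refine Or.inr ⟨fun x hx => hv x (by simp [hx]), u ++ w, ?_, by simpa using htr⟩
      have := M.trace_cons_of_indep (u := w) fun x hx => hv x (by simp [hx])
      simpa using M.trace_append_congr (rfl : M.trace u = _) this

/-- `p` is a word of a prime trace with last letter `a`. -/
def IsPrimeWord (a : A) (p : List A) : Prop := ∀ σ, M.trace σ = M.trace p → σ.getLast? = some a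

variable {M}

theorem IsPrimeWord.exists_eq {a : A} {p : List A} (hp : M.IsPrimeWord a p) :
    ∃ p', p = p' ++ [a] := by
  obtain ⟨ys, h⟩ := List.getLast?_eq_some_iff.1 (hp p rfl)
  exact ⟨ys, h⟩

theorem IsPrimeWord.eq_of_concat {a b : A} {p σ : List A} (hp : M.IsPrimeWord a p)
    (h : M.trace p = M.trace (σ ++ [b])) : b = a := by
  simpa using hp _ h.symm

/-- A prefix of `τ b` that is not a prefix of `τ` uses the final `b` and can be rewritten to end
with it, which primality excludes for `b ≠ a`. -/
theorem IsPrimeWord.prefix_of_concat {a b : A} {p τ : List A} (hp : M.IsPrimeWord a p)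
    (h : M.Prefix (M.trace p) (M.trace (τ ++ [b]))) (hab : b ≠ a) :
    M.Prefix (M.trace p) (M.trace τ) := by
  obtain ⟨ρ, hρ⟩ := M.prefix_iff.1 h
  rcases M.prefix_concat_cases hρ with h₁ | ⟨_, σ', h₁, _⟩
  · exact h₁
  · exact absurd (hp.eq_of_concat h₁) hab

theorem IsPrimeWord.prefix_of_append {a : A} {p τ ρ : List A} (hp : M.IsPrimeWord a p)
    (h : M.Prefix (M.trace p) (M.trace (τ ++ ρ))) (ha : a ∉ ρ) :
    M.Prefix (M.trace p) (M.trace τ) := by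
  induction ρ using List.reverseRecOn with
  | nil => simpa using h
  | append_singleton ρ b ih =>
    simp only [List.mem_append, List.mem_singleton, not_or] at ha
    rw [← List.append_assoc] at h
    exact ih (hp.prefix_of_concat h (Ne.symm ha.2)) ha.1

/-- Two prime prefixes of `τ a` that are not prefixes of `τ` are comparable, in fact equal. -/
theorem IsPrimeWord.prefix_of_new {a b c : A} {p q τ : List A} (hp : M.IsPrimeWord a p)
    (hq : M.IsPrimeWord b q)
    (hpt : M.Prefix (M.trace p) (M.trace (τ ++ [c])))
    (hqt : M.Prefix (M.trace q) (M.trace (τ ++ [c])))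
    (hq' : ¬ M.Prefix (M.trace q) (M.trace τ)) (hab : ¬ M.indep b a) :
    M.Prefix (M.trace p) (M.trace q) := by
  obtain ⟨ρ, hρ⟩ := M.prefix_iff.1 hqt
  rcases M.prefix_concat_cases hρ with h₁ | ⟨hind, σ, h₁, _⟩
  · exact absurd h₁ hq'
  · rw [← hρ] at hpt
    obtain rfl := hq.eq_of_concat h₁
    exact hp.prefix_of_append hpt fun ha => hab (hind a ha)

/-- Both primes must end with `c`, and `c` is not independent of itself, so `prefix_of_new` applies
in both directions. This is the uniqueness of the event added by one letter. -/
theorem IsPrimeWord.eq_of_new {a b c : A} {p q τ : List A} (hp : M.IsPrimeWord a p)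
    (hq : M.IsPrimeWord b q)
    (hpt : M.Prefix (M.trace p) (M.trace (τ ++ [c])))
    (hqt : M.Prefix (M.trace q) (M.trace (τ ++ [c])))
    (hp' : ¬ M.Prefix (M.trace p) (M.trace τ))
    (hq' : ¬ M.Prefix (M.trace q) (M.trace τ)) :
    M.trace p = M.trace q := by
  have hac : c = a := by
    by_contra h; exact hp' (hp.prefix_of_concat hpt h)
  have hbc : c = b := by
    by_contra h; exact hq' (hq.prefix_of_concat hqt h)
  subst hac hbc
  exact M.prefix_antisymm (hp.prefix_of_new hq hpt hqt hq' (M.irrefl _))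
    (hq.prefix_of_new hp hqt hpt hp' (M.irrefl _))

/-- Prime prefixes of a trace with dependent last letters are comparable. -/
theorem IsPrimeWord.comparable {a b : A} {p q τ : List A} (hp : M.IsPrimeWord a p)
    (hq : M.IsPrimeWord b q) (hpt : M.Prefix (M.trace p) (M.trace τ))
    (hqt : M.Prefix (M.trace q) (M.trace τ)) (hab : ¬ M.indep a b) :
    M.Prefix (M.trace p) (M.trace q) ∨ M.Prefix (M.trace q) (M.trace p) := by
  induction τ using List.reverseRecOn with
  | nil =>
    obtain ⟨p', rfl⟩ := hp.exists_eq
    simpa using M.prefix_length hpt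
  | append_singleton τ c ih =>
    by_cases hp' : M.Prefix (M.trace p) (M.trace τ)
    · by_cases hq' : M.Prefix (M.trace q) (M.trace τ)
      · exact ih hp' hq'
      · exact Or.inl (hp.prefix_of_new hq hpt hqt hq' fun h => hab (M.symm _ _ h))
    · exact Or.inr (hq.prefix_of_new hp hqt hpt hp' hab)

/-- A proper prefix of a prime trace `p a` is a prefix of `p`. -/
theorem IsPrimeWord.prefix_init {a : A} {p σ : List A} (hp : M.IsPrimeWord a (p ++ [a]))
    (h : M.Prefix (M.trace σ) (M.trace (p ++ [a]))) (hne : M.trace σ ≠ M.trace (p ++ [a])) :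
    M.Prefix (M.trace σ) (M.trace p) := by
  obtain ⟨ρ, hρ⟩ := M.prefix_iff.1 h
  rcases M.prefix_concat_cases hρ with h₁ | ⟨hind, σ', h₁, h₂⟩
  · exact h₁
  -- A nonempty complement `ρ` consists of letters independent of `a`, yet by primality its last
  -- letter is `a`.
  · rcases List.eq_nil_or_concat' ρ with rfl | ⟨ρ', b, rfl⟩
    · exact absurd (by simpa using hρ) hne
    · rw [← List.append_assoc] at hρ
      obtain rfl := hp.eq_of_concat hρ.symm
      exact absurd (hind b (by simp)) (M.irrefl b)

variable (M)

/-- A shortest prefix of `σ a` that is not a prefix of `σ` is prime: deleting a last letter other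
than `a` would give a shorter prefix with the same number of `a`s, one too many for a prefix of `σ`.
-/
theorem exists_prime_new (σ : List A) (a : A) :
    ∃ p, M.IsPrimeWord a (p ++ [a]) ∧ M.Prefix (M.trace (p ++ [a])) (M.trace (σ ++ [a])) ∧
      ¬ M.Prefix (M.trace (p ++ [a])) (M.trace σ) := by
  classical
  have hex : ∃ n, ∃ ρ : List A, ρ.length = n ∧ M.Prefix (M.trace ρ) (M.trace (σ ++ [a])) ∧
      ¬ M.Prefix (M.trace ρ) (M.trace σ) :=
    ⟨_, σ ++ [a], rfl, M.prefix_refl _, fun h => by simpa using M.prefix_length h⟩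
  obtain ⟨ρ, hlen, hρ, hρ'⟩ := Nat.find_spec hex
  have hmin : ∀ ρ' : List A, ρ'.length < ρ.length →
      M.Prefix (M.trace ρ') (M.trace (σ ++ [a])) → M.Prefix (M.trace ρ') (M.trace σ) := by
    intro ρ' hl h
    by_contra h'
    exact Nat.find_min hex (hlen ▸ hl) ⟨ρ', rfl, h, h'⟩
  obtain ⟨r, hr⟩ := M.prefix_iff.1 hρ
  rcases M.prefix_concat_cases hr with h₁ | ⟨hind, q, h₁, h₂⟩
  · exact absurd h₁ hρ'
  · refine ⟨q, ?_, h₁ ▸ hρ, h₁ ▸ hρ'⟩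
    intro τ hτ
    rcases List.eq_nil_or_concat' τ with rfl | ⟨τ', b, rfl⟩
    · simpa using M.trace_length_eq hτ
    rw [List.getLast?_concat]
    by_contra hne
    have hba : b ≠ a := fun h => hne (by rw [h])
    have hτ' : M.Prefix (M.trace τ') (M.trace σ) := by
      refine hmin τ' ?_ (M.prefix_trans (M.prefix_append τ' [b]) ?_)
      · have := M.trace_length_eq hτ
        have := M.trace_length_eq h₁
        simp at *; omega
      · rw [hτ, ← h₁]; exact hρ
    -- Count the letter `a`: `τ'` has one more than `q`, while `σ` has as many as `q` because `r`
    -- has none.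
    have h₃ := (M.proj_prefix hτ' (M.irrefl a)).length_le
    have h₄ := congrArg List.length (M.proj_eq_of_trace_eq hτ (M.irrefl a))
    have h₅ := congrArg List.length (M.proj_eq_of_trace_eq h₂ (M.irrefl a))
    have h₆ : proj a a r = [] := proj_eq_nil fun x hx h => by
      have := hind x hx
      rcases h with rfl | rfl <;> exact M.irrefl _ this
    rw [proj_append, proj_append, proj_singleton_of_mem (Or.inl rfl),
      proj_singleton_of_not_mem (by simpa using hba)] at h₄
    rw [proj_append, h₆] at h₅
    simp at h₃ h₄ h₅
    omega

/-- The prefix order on traces is determined by prime prefixes. -/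
theorem prefix_of_primes {σ τ : List A}
    (h : ∀ a p, M.IsPrimeWord a p → M.Prefix (M.trace p) (M.trace σ) →
      M.Prefix (M.trace p) (M.trace τ)) : M.Prefix (M.trace σ) (M.trace τ) := by
  induction σ using List.reverseRecOn with
  | nil => exact M.prefix_append [] τ
  | append_singleton σ a ih =>
    have hσ : M.Prefix (M.trace σ) (M.trace τ) :=
      ih fun b p hp hps => h b p hp (M.prefix_trans hps (M.prefix_append σ [a]))
    obtain ⟨p, hp, hpσ, hpn⟩ := M.exists_prime_new σ a
    have hpτ := h a _ hp hpσ
    obtain ⟨r, hr⟩ := M.prefix_iff.1 hpσ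
    rcases M.prefix_concat_cases hr with h₁ | ⟨hind, q, h₁, h₂⟩
    · exact absurd h₁ hpn
    have hqp : M.trace q = M.trace p := M.trace_cancel_right h₁.symm
    refine M.prefix_of_proj fun b c hbc => ?_
    -- On a dependent pair containing `a`, the complement `r` is invisible, so `σ a` projects like
    -- the new prime, a prefix of `τ`. On any other pair the final `a` is invisible.
    by_cases ha : a = b ∨ a = c
    · have h₃ := M.proj_prefix hpτ hbc
      have h₄ : proj b c r = [] := proj_eq_nil fun x hx hxbc => by
        have h₅ := hind x hx
        have h₆ := M.symm _ _ h₅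
        rcases ha with rfl | rfl <;> rcases hxbc with rfl | rfl <;>
          first | exact M.irrefl _ h₅ | exact hbc h₅ | exact hbc h₆
      have h₅ := M.proj_eq_of_trace_eq h₂ hbc
      rw [proj_append, h₄, List.append_nil, M.proj_eq_of_trace_eq hqp hbc] at h₅
      rwa [proj_append, ← h₅, ← proj_append]
    · rw [proj_append, proj_singleton_of_not_mem ha, List.append_nil]
      exact M.proj_prefix hσ hbc

/-- `t = s a`. -/
def Extends (s : M.Trace) (a : A) (t : M.Trace) : Prop :=
  ∃ σ, M.trace σ = s ∧ M.trace (σ ++ [a]) = t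

theorem extends_iff {σ τ : List A} {a : A} :
    M.Extends (M.trace σ) a (M.trace τ) ↔ M.trace (σ ++ [a]) = M.trace τ :=
  ⟨fun ⟨_, h₁, h₂⟩ => (M.trace_append_congr h₁ rfl).symm.trans h₂, fun h => ⟨σ, rfl, h⟩⟩

end TraceAlphabet

/-! ### Maximal events of configurations -/

namespace LabeledEventStructure

variable {Λ : Type v} (E : LabeledEventStructure.{u} Λ)

theorem Config.ext_carrier {E : LabeledEventStructure.{u} Λ} {c c' : E.Config}
    (h : c.carrier = c'.carrier) : c = c' := by
  cases c; cases c'; simp at h; subst h; rfl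

/-- Every event of a configuration is below a maximal one. -/
theorem Config.exists_maximal_above {E : LabeledEventStructure.{u} Λ} (c : E.Config)
    {x : E.Event} (hx : x ∈ c.carrier) :
    ∃ e ∈ c.carrier, E.le x e ∧ ∀ e' ∈ c.carrier, E.le e e' → e' = e := by
  let _ : PartialOrder E.Event :=
    { le := E.le
      le_refl := E.le_refl
      le_trans := E.le_trans
      le_antisymm := E.le_antisymm }
  obtain ⟨e, hxe, he⟩ := c.finite.exists_le_maximal hx
  exact ⟨e, he.prop, hxe, fun e' he' h => E.le_antisymm _ _ (he.le_of_ge he' h) h⟩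

/-- The configuration obtained by removing a maximal event. -/
def Config.erase {E : LabeledEventStructure.{u} Λ} (c : E.Config) (e : E.Event)
    (h : ∀ e' ∈ c.carrier, E.le e e' → e' = e) : E.Config where
  carrier := c.carrier \ {e}
  finite := c.finite.sdiff
  conflictFree a ha b hb := c.conflictFree a ha.1 b hb.1
  downClosed a ha b hb :=
    ⟨c.downClosed a ha.1 b hb, fun hbe =>
      ha.2 (h a ha.1 (by rw [← Set.mem_singleton_iff.1 hbe]; exact hb))⟩

theorem Config.hasseEdge_erase {E : LabeledEventStructure.{u} Λ} (c : E.Config) {e : E.Event}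
    (he : e ∈ c.carrier) (h : ∀ e' ∈ c.carrier, E.le e e' → e' = e) :
    E.HasseEdge (c.erase e h) (E.label e) c :=
  ⟨e, fun h' => h'.2 rfl, (Set.insert_sdiff_self_of_mem he).symm, rfl⟩

end LabeledEventStructure

namespace NetSystem

variable {S : Type u} {T : Type v} (N : NetSystem S T)

/-! ### Firing sequences -/

variable {N} in
theorem indep_not_mem {a b : T} (h : N.alphabet.indep a b) (s : S) :
    ¬ ((s ∈ N.pre a ∨ s ∈ N.post a) ∧ (s ∈ N.pre b ∨ s ∈ N.post b)) := fun hs =>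
  (Set.ext_iff.1 h.2 s).1 hs

theorem fires_iff {m : Set S} {a : T} {m' : Set S} :
    N.Fires m a m' ↔ (∀ s ∈ N.pre a, s ∈ m) ∧ (∀ s ∈ N.post a, s ∈ m → s ∈ N.pre a) ∧
      ∀ s, s ∈ m' ↔ (s ∈ m ∧ s ∉ N.pre a) ∨ s ∈ N.post a := by
  unfold Fires
  refine and_congr Iff.rfl (and_congr ?_ ?_)
  · rw [Set.eq_empty_iff_forall_notMem]
    refine forall_congr' fun s => ?_
    simp only [Set.mem_inter_iff, Set.mem_sdiff]
    tauto
  · rw [Set.ext_iff]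
    rfl

variable {N}

theorem Fires.unique {m m₁ m₂ : Set S} {a : T} (h₁ : N.Fires m a m₁) (h₂ : N.Fires m a m₂) :
    m₁ = m₂ := h₁.2.2.trans h₂.2.2.symm

/-- Firing an independent transition does not disable a transition. -/
theorem Fires.diamond {m m₁ m₂ : Set S} {a b : T} (hab : N.alphabet.indep a b)
    (h₁ : N.Fires m a m₁) (h₂ : N.Fires m b m₂) : ∃ m₃, N.Fires m₂ a m₃ := by
  refine ⟨(m₂ \ N.pre a) ∪ N.post a, N.fires_iff.2 ⟨?_, ?_, fun s => Iff.rfl⟩⟩ <;>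
  · intro s
    have h := indep_not_mem hab s
    have h₁' := (N.fires_iff.1 h₁).1 s
    have h₂' := (N.fires_iff.1 h₁).2.1 s
    have h₃' := (N.fires_iff.1 h₂).2.2 s
    grind

/-- No place is touched by both transitions, so the firing conditions can be checked place by place.
-/
theorem Fires.swap {m m₁ m₂ : Set S} {a b : T} (hab : N.alphabet.indep a b)
    (h₁ : N.Fires m a m₁) (h₂ : N.Fires m₁ b m₂) :
    ∃ m', N.Fires m b m' ∧ N.Fires m' a m₂ := by
  obtain ⟨m', hm'⟩ : ∃ m', m' = (m \ N.pre b) ∪ N.post b := ⟨_, rfl⟩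
  have hm : ∀ s, s ∈ m' ↔ (s ∈ m ∧ s ∉ N.pre b) ∨ s ∈ N.post b := fun s => by rw [hm']; rfl
  refine ⟨m', N.fires_iff.2 ⟨?_, ?_, hm⟩, N.fires_iff.2 ⟨?_, ?_, ?_⟩⟩ <;>
  · intro s
    have h := indep_not_mem hab s
    have h₀' := hm s
    have h₁' := (N.fires_iff.1 h₁).1 s
    have h₂' := (N.fires_iff.1 h₁).2.1 s
    have h₃' := (N.fires_iff.1 h₁).2.2 s
    have h₄' := (N.fires_iff.1 h₂).1 s
    have h₅' := (N.fires_iff.1 h₂).2.1 s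
    have h₆' := (N.fires_iff.1 h₂).2.2 s
    clear h₁ h₂ hab hm hm'
    grind

theorem firesWord_append {m m' : Set S} {σ τ : List T} :
    N.FiresWord m (σ ++ τ) m' ↔ ∃ m₁, N.FiresWord m σ m₁ ∧ N.FiresWord m₁ τ m' := by
  induction σ generalizing m with
  | nil => simp [FiresWord]
  | cons a σ ih =>
    simp only [List.cons_append, FiresWord, ih]
    constructor
    · rintro ⟨m₁, h, m₂, h₁, h₂⟩; exact ⟨m₂, ⟨m₁, h, h₁⟩, h₂⟩
    · rintro ⟨m₂, ⟨m₁, h, h₁⟩, h₂⟩; exact ⟨m₁, h, m₂, h₁, h₂⟩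

theorem firesWord_singleton {m m' : Set S} {a : T} : N.FiresWord m [a] m' ↔ N.Fires m a m' := by
  simp [FiresWord]

theorem FiresWord.of_trace_eq {m m' : Set S} {σ τ : List T} (h : N.FiresWord m σ m')
    (hστ : N.alphabet.trace σ = N.alphabet.trace τ) : N.FiresWord m τ m' := by
  replace hστ := N.alphabet.trace_eq_iff.1 hστ
  induction hστ with
  | refl => exact h
  | tail _ hs ih =>
    obtain ⟨α, β, a, b, hab, rfl, rfl⟩ := hs
    obtain ⟨m₁, h₁, m₂, h₂, m₃, h₃, h₄⟩ := firesWord_append.1 ih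
    obtain ⟨m₄, h₅, h₆⟩ := h₂.swap hab h₃
    exact firesWord_append.2 ⟨m₁, h₁, m₄, h₅, m₃, h₆, h₄⟩

theorem FiresWord.unique {m m₁ m₂ : Set S} {σ : List T} (h₁ : N.FiresWord m σ m₁)
    (h₂ : N.FiresWord m σ m₂) : m₁ = m₂ := by
  induction σ generalizing m with
  | nil => exact h₁.symm.trans h₂
  | cons a σ ih =>
    obtain ⟨m', h, h₁⟩ := h₁
    obtain ⟨m'', h', h₂⟩ := h₂
    exact ih h₁ (h'.unique h ▸ h₂)

/-- A transition independent of a firing sequence stays enabled. -/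
theorem FiresWord.persist {m m₁ m₂ : Set S} {σ : List T} {a : T} (h : N.FiresWord m σ m₂)
    (ha : N.Fires m a m₁) (hind : ∀ x ∈ σ, N.alphabet.indep a x) : ∃ m₃, N.Fires m₂ a m₃ := by
  induction σ generalizing m m₁ with
  | nil => cases h; exact ⟨m₁, ha⟩
  | cons b σ ih =>
    obtain ⟨m', h₁, h₂⟩ := h
    obtain ⟨m₃, h₃⟩ := ha.diamond (hind b (by simp)) h₁
    exact ih h₂ h₃ fun x hx => hind x (by simp [hx])

variable (N)

theorem trace_mem_firingTraces {σ : List T} :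
    N.alphabet.trace σ ∈ N.firingTraces ↔ ∃ m, N.FiresWord N.initial σ m :=
  ⟨fun ⟨_, m, h, h'⟩ => ⟨m, h.of_trace_eq h'⟩, fun ⟨m, h⟩ => ⟨σ, m, h, rfl⟩⟩

theorem firingTraces_of_prefix {s t : N.alphabet.Trace} (ht : t ∈ N.firingTraces)
    (h : N.alphabet.Prefix s t) : s ∈ N.firingTraces := by
  obtain ⟨σ, τ, rfl, rfl, ρ, rfl⟩ := h
  obtain ⟨m, hm⟩ := N.trace_mem_firingTraces.1 ht
  obtain ⟨m₁, h₁, _⟩ := firesWord_append.1 hm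
  exact N.trace_mem_firingTraces.2 ⟨m₁, h₁⟩

/-! ### The domain of the event structure unfolding -/

/-- `g` identifies the domain of `E` with the firing traces. -/
def IsTraceDomain (E : LabeledEventStructure.{w} T) (g : E.Config ≃ N.firingTraces) : Prop :=
  (∀ c c', c.carrier ⊆ c'.carrier ↔ N.alphabet.Prefix (g c).1 (g c').1) ∧
    ∀ c a c', E.HasseEdge c a c' ↔ N.alphabet.Extends (g c).1 a (g c').1

variable [Finite T]

theorem unfolding_event_word (e : N.unfolding.Event) :
    ∃ p, N.alphabet.IsPrimeWord (N.unfolding.label e) (p ++ [N.unfolding.label e]) ∧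
      N.alphabet.trace (p ++ [N.unfolding.label e]) = e.1 := by
  obtain ⟨q, hq⟩ := N.alphabet.exists_trace e.1
  have h : N.alphabet.IsPrimeWord (N.unfolding.label e) q := fun σ hσ =>
    e.2.2.choose_spec σ (hσ.trans hq)
  obtain ⟨p, rfl⟩ := h.exists_eq
  exact ⟨p, h, hq⟩

theorem exists_unfolding_event {a : T} {p : List T} (hp : N.alphabet.IsPrimeWord a p)
    (hf : N.alphabet.trace p ∈ N.firingTraces) :
    ∃ e : N.unfolding.Event, e.1 = N.alphabet.trace p ∧ N.unfolding.label e = a := by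
  let e : N.unfolding.Event := ⟨N.alphabet.trace p, hf, a, hp⟩
  refine ⟨e, rfl, ?_⟩
  exact Option.some_injective _ ((e.2.2.choose_spec p rfl).symm.trans (hp p rfl))

/-- The configuration of all prime prefixes of a firing trace. -/
def primeConfig (t : N.firingTraces) : N.unfolding.Config where
  carrier := {e | N.alphabet.Prefix e.1 t.1}
  finite := Set.Finite.preimage (f := Subtype.val) (s := {s | N.alphabet.Prefix s t.1})
      Subtype.val_injective.injOn (N.alphabet.finite_prefix t.1)
  conflictFree _ ha _ hb h := h ⟨t.1, t.2, ha, hb⟩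
  downClosed _ ha _ hb := N.alphabet.prefix_trans hb ha

theorem mem_primeConfig {t : N.firingTraces} {e : N.unfolding.Event} :
    e ∈ (N.primeConfig t).carrier ↔ N.alphabet.Prefix e.1 t.1 := Iff.rfl

theorem primeConfig_subset {s t : N.firingTraces} :
    (N.primeConfig s).carrier ⊆ (N.primeConfig t).carrier ↔ N.alphabet.Prefix s.1 t.1 := by
  refine ⟨fun h => ?_, fun h e he => N.alphabet.prefix_trans he h⟩
  obtain ⟨σ, hσ⟩ := N.alphabet.exists_trace s.1
  obtain ⟨τ, hτ⟩ := N.alphabet.exists_trace t.1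
  rw [← hσ, ← hτ]
  refine N.alphabet.prefix_of_primes fun a p hp hps => ?_
  rw [hσ] at hps
  rw [hτ]
  obtain ⟨e, he, _⟩ := N.exists_unfolding_event hp (N.firingTraces_of_prefix s.2 hps)
  rw [← he] at hps ⊢
  exact h hps

theorem primeConfig_injective : Function.Injective N.primeConfig := fun s t h =>
  Subtype.ext (N.alphabet.prefix_antisymm
    (N.primeConfig_subset.1 (by rw [h])) (N.primeConfig_subset.1 (by rw [h])))

theorem hasseEdge_of_extends {s t : N.firingTraces} {a : T}
    (h : N.alphabet.Extends s.1 a t.1) :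
    N.unfolding.HasseEdge (N.primeConfig s) a (N.primeConfig t) := by
  obtain ⟨s, hs⟩ := s
  obtain ⟨t, ht⟩ := t
  obtain ⟨σ, h₁, h₂⟩ := h
  simp only at h₁ h₂
  subst h₁ h₂
  obtain ⟨p, hp, hpt, hps⟩ := N.alphabet.exists_prime_new σ a
  obtain ⟨e, he, hea⟩ := N.exists_unfolding_event hp (N.firingTraces_of_prefix ht hpt)
  refine ⟨e, by rwa [mem_primeConfig, he], ?_, hea⟩
  ext d
  rw [Set.mem_insert_iff, mem_primeConfig, mem_primeConfig]
  constructor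
  -- A prime prefix of `t` that is not a prefix of `s` is new, hence equal to `e`.
  · intro hd
    by_contra hne
    rw [not_or] at hne
    obtain ⟨q, hq, hqd⟩ := N.unfolding_event_word d
    rw [← hqd] at hd hne
    exact hne.1 (Subtype.ext (hqd.symm.trans ((hq.eq_of_new hp hd hpt hne.2 hps).trans he.symm)))
  · rintro (rfl | hd)
    · rwa [he]
    · exact N.alphabet.prefix_trans hd (N.alphabet.prefix_append σ [a])

theorem hasseEdge_primeConfig_iff {s t : N.firingTraces} {a : T} :
    N.unfolding.HasseEdge (N.primeConfig s) a (N.primeConfig t) ↔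
      N.alphabet.Extends s.1 a t.1 := by
  refine ⟨?_, N.hasseEdge_of_extends⟩
  rintro ⟨e, hes, het, rfl⟩
  have hst : N.alphabet.Prefix s.1 t.1 :=
    N.primeConfig_subset.1 (het ▸ Set.subset_insert _ _)
  obtain ⟨σ, τ, hσ, hτ, ρ, rfl⟩ := hst
  cases ρ with
  | nil =>
    have : s = t := Subtype.ext (by rw [← hσ, ← hτ, List.append_nil])
    subst this
    exact absurd (het ▸ Set.mem_insert e _) hes
  | cons b ρ =>
    -- The first letter after `σ` already adds one event. Only `e` is available, so the intermediate
    -- trace is all of `t`.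
    have hpre : N.alphabet.Prefix (N.alphabet.trace (σ ++ [b])) t.1 := by
      rw [← hτ]
      simpa using N.alphabet.prefix_append (σ ++ [b]) ρ
    let r : N.firingTraces := ⟨_, N.firingTraces_of_prefix t.2 hpre⟩
    have hsr : N.alphabet.Extends s.1 b r.1 := ⟨σ, hσ, rfl⟩
    obtain ⟨d, hds, hdr, hdb⟩ := N.hasseEdge_of_extends hsr
    have hrt : (N.primeConfig r).carrier ⊆ (N.primeConfig t).carrier :=
      N.primeConfig_subset.2 hpre
    have hde : d = e := by
      have h₁ : d ∈ (N.primeConfig t).carrier := hrt (hdr ▸ Set.mem_insert d _)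
      rw [het] at h₁
      exact h₁.resolve_right hds
    subst hde
    have : r = t := N.primeConfig_injective
      (LabeledEventStructure.Config.ext_carrier (hdr.trans het.symm))
    rw [← this, hdb]
    exact hsr

/-- Removing a maximal event `e` leaves, by induction, the primes of some `σ`. Writing `e` as `p a`,
one shows that `σ` is `p` followed by letters independent of `a`; then `σ a` fires and its only new
prime is `e`. -/
theorem primeConfig_surjective : Function.Surjective N.primeConfig := by
  intro c
  induction hn : c.carrier.ncard generalizing c with
  | zero =>
    have hc : c.carrier = ∅ := (Set.ncard_eq_zero c.finite).1 hn
    refine ⟨⟨N.alphabet.trace [], N.trace_mem_firingTraces.2 ⟨_, rfl⟩⟩,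
      LabeledEventStructure.Config.ext_carrier ?_⟩
    rw [hc, Set.eq_empty_iff_forall_notMem]
    intro e he
    obtain ⟨p, _, hpe⟩ := N.unfolding_event_word e
    rw [mem_primeConfig, ← hpe] at he
    simpa using N.alphabet.prefix_length he
  | succ n ih =>
    have hne : c.carrier.Nonempty := Set.nonempty_of_ncard_ne_zero (by omega)
    obtain ⟨x, hx⟩ := hne
    obtain ⟨e, hec, _, hmax⟩ := c.exists_maximal_above hx
    obtain ⟨s, hs⟩ := ih (c.erase e hmax) (by
      have := Set.ncard_sdiff_singleton_add_one hec c.finite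
      have h' : (c.erase e hmax).carrier = c.carrier \ {e} := rfl
      rw [h']; omega)
    have hs' : ∀ d, N.alphabet.Prefix d.1 s.1 ↔ d ∈ c.carrier ∧ d ≠ e := fun d => by
      rw [← mem_primeConfig, hs]; rfl
    obtain ⟨s, hsf⟩ := s
    simp only at hs'
    obtain ⟨σ, rfl⟩ := N.alphabet.exists_trace s
    obtain ⟨p, hp, hpe⟩ := N.unfolding_event_word e
    set a := N.unfolding.label e with ha
    have hes : ¬ N.alphabet.Prefix e.1 (N.alphabet.trace σ) := fun h => ((hs' e).1 h).2 rfl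
    have hef : N.alphabet.trace (p ++ [a]) ∈ N.firingTraces := hpe ▸ e.2.1
    -- Prime prefixes of `p` are events strictly below `e`, so they remain after `e` is removed.
    have hps : N.alphabet.Prefix (N.alphabet.trace p) (N.alphabet.trace σ) := by
      refine N.alphabet.prefix_of_primes fun b q hq hqp => ?_
      have hqe := N.alphabet.prefix_trans hqp (N.alphabet.prefix_append p [a])
      obtain ⟨d, hd, _⟩ := N.exists_unfolding_event hq (N.firingTraces_of_prefix hef hqe)
      rw [← hd, hs']
      rw [← hd, hpe] at hqe
      refine ⟨c.downClosed e hec d hqe, ?_⟩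
      rintro rfl
      rw [← hd, ← hpe] at hqp
      simpa using N.alphabet.prefix_length hqp
    obtain ⟨r, hr⟩ := N.alphabet.prefix_iff.1 hps
    -- A letter `x` of `r` dependent on `a` would create an event `d` of `c`. As `d` and `e` are not
    -- in conflict, they are comparable: `e ≤ d` puts `e` below `σ`, and `d < e` puts `d` below `p`,
    -- before `x` occurs.
    have hind : ∀ x ∈ r, N.alphabet.indep a x := by
      intro x hx
      by_contra hax
      obtain ⟨r₁, r₂, rfl⟩ := List.append_of_mem hx
      obtain ⟨q, hq, hqr, hqn⟩ := N.alphabet.exists_prime_new (p ++ r₁) x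
      have hqs : N.alphabet.Prefix (N.alphabet.trace (q ++ [x])) (N.alphabet.trace σ) := by
        refine N.alphabet.prefix_trans hqr ?_
        rw [← hr]
        simpa using N.alphabet.prefix_append (p ++ r₁ ++ [x]) r₂
      obtain ⟨d, hd, _⟩ := N.exists_unfolding_event hq (N.firingTraces_of_prefix hsf hqs)
      have hdc := (hs' d).1 (hd ▸ hqs)
      obtain ⟨t, _, hdt, het⟩ := not_not.1 (c.conflictFree d hdc.1 e hec)
      obtain ⟨τ, rfl⟩ := N.alphabet.exists_trace t
      rw [hd] at hdt
      rw [← hpe] at het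
      rcases hp.comparable hq het hdt hax with h | h
      · exact hes (hpe ▸ N.alphabet.prefix_trans h hqs)
      · refine hqn (N.alphabet.prefix_trans (hp.prefix_init h fun h' => ?_)
          (N.alphabet.prefix_append p r₁))
        exact hdc.2 (Subtype.ext (hd.trans (h'.trans hpe)))
    have htf : N.alphabet.trace (σ ++ [a]) ∈ N.firingTraces := by
      obtain ⟨m₁, hm₁⟩ := N.trace_mem_firingTraces.1 hef
      obtain ⟨m₂, hm₂⟩ := N.trace_mem_firingTraces.1 hsf
      obtain ⟨m₃, h₁, h₂⟩ := firesWord_append.1 hm₁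
      obtain ⟨m₄, h₃, h₄⟩ := firesWord_append.1 (hm₂.of_trace_eq hr.symm)
      obtain rfl : m₃ = m₄ := FiresWord.unique h₁ h₃
      obtain ⟨m₅, h₅⟩ := h₄.persist (firesWord_singleton.1 h₂) hind
      exact N.trace_mem_firingTraces.2
        ⟨m₅, firesWord_append.2 ⟨m₂, hm₂, firesWord_singleton.2 h₅⟩⟩
    refine ⟨⟨_, htf⟩, LabeledEventStructure.Config.ext_carrier ?_⟩
    obtain ⟨d, hds, hdt, hda⟩ := N.hasseEdge_of_extends
      (s := ⟨_, hsf⟩) (t := ⟨_, htf⟩) (a := a) ⟨σ, rfl, rfl⟩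
    have het : e ∈ (N.primeConfig ⟨_, htf⟩).carrier := by
      rw [mem_primeConfig, ← hpe]
      refine N.alphabet.prefix_iff.2 ⟨r, ?_⟩
      have h₁ := N.alphabet.trace_append_congr (rfl : N.alphabet.trace p = _)
        (N.alphabet.trace_cons_of_indep hind)
      have h₂ := N.alphabet.trace_append_congr hr (rfl : N.alphabet.trace [a] = _)
      rw [List.append_assoc, List.singleton_append, h₁, ← h₂, List.append_assoc]
    rw [hdt] at het ⊢
    rw [hs] at het ⊢
    obtain rfl : e = d := het.resolve_right fun h => h.2 rfl
    exact Set.insert_sdiff_self_of_mem hec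

/-- The domain of the event structure unfolding consists of the firing traces. -/
theorem exists_isTraceDomain_unfolding :
    ∃ g : N.unfolding.Config ≃ N.firingTraces, N.IsTraceDomain N.unfolding g := by
  let h := Equiv.ofBijective _ ⟨N.primeConfig_injective, N.primeConfig_surjective⟩
  refine ⟨h.symm, fun c c' => ?_, fun c a c' => ?_⟩
  · obtain ⟨s, rfl⟩ := h.surjective c
    obtain ⟨t, rfl⟩ := h.surjective c'
    rw [h.symm_apply_apply, h.symm_apply_apply]
    exact N.primeConfig_subset
  · obtain ⟨s, rfl⟩ := h.surjective c
    obtain ⟨t, rfl⟩ := h.surjective c'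
    rw [h.symm_apply_apply, h.symm_apply_apply]
    exact N.hasseEdge_primeConfig_iff

end NetSystem

/-! ### Directed paths and homotopy invariants -/

namespace DirectedSquareComplex

variable {Λ : Type w} {X : DirectedSquareComplex.{u, v} Λ}

/-- `σ` is the word of labels of a directed path from `x` to `y`. -/
def DirPath (X : DirectedSquareComplex.{u, v} Λ) : X.Vertex → List Λ → X.Vertex → Prop
  | x, [], y => x = y
  | x, a :: σ, y => ∃ e, X.source e = x ∧ X.label e = a ∧ DirPath X (X.target e) σ y

theorem dirPath_append {x y : X.Vertex} {σ τ : List Λ} :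
    X.DirPath x (σ ++ τ) y ↔ ∃ z, X.DirPath x σ z ∧ X.DirPath z τ y := by
  induction σ generalizing x with
  | nil => simp [DirPath]
  | cons a σ ih =>
    simp only [List.cons_append, DirPath, ih]
    constructor
    · rintro ⟨e, h₁, h₂, z, h₃, h₄⟩; exact ⟨z, ⟨e, h₁, h₂, h₃⟩, h₄⟩
    · rintro ⟨z, ⟨e, h₁, h₂, h₃⟩, h₄⟩; exact ⟨e, h₁, h₂, z, h₃, h₄⟩

theorem dirPath_singleton {x y : X.Vertex} {a : Λ} :
    X.DirPath x [a] y ↔ ∃ e, X.source e = x ∧ X.target e = y ∧ X.label e = a := by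
  simp only [DirPath]
  exact ⟨fun ⟨e, h₁, h₂, h₃⟩ => ⟨e, h₁, h₃, h₂⟩, fun ⟨e, h₁, h₃, h₂⟩ => ⟨e, h₁, h₂, h₃⟩⟩

theorem dirReach_iff {x y : X.Vertex} : X.DirReach x y ↔ ∃ σ, X.DirPath x σ y := by
  constructor
  · intro h
    induction h with
    | refl => exact ⟨[], rfl⟩
    | tail _ h ih =>
      obtain ⟨σ, hσ⟩ := ih
      obtain ⟨e, h₁, h₂⟩ := h
      exact ⟨σ ++ [X.label e], dirPath_append.2 ⟨_, hσ, dirPath_singleton.2 ⟨e, h₁, h₂, rfl⟩⟩⟩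
  · rintro ⟨σ, hσ⟩
    induction σ generalizing x with
    | nil => cases hσ; exact Relation.ReflTransGen.refl
    | cons a σ ih =>
      obtain ⟨e, h₁, _, h₃⟩ := hσ
      exact Relation.ReflTransGen.head ⟨e, h₁, rfl⟩ (ih h₃)

theorem isPath_append {x y z : X.Vertex} {l l' : List (X.Edge × Bool)} (h : X.IsPath x l y)
    (h' : X.IsPath y l' z) : X.IsPath x (l ++ l') z := by
  induction l generalizing x with
  | nil => cases h; exact h'
  | cons s l ih => exact ⟨h.1, ih h.2⟩

/-- The reversed path is provided too, so that two directed paths can be closed up to a loop. -/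
theorem DirPath.exists_isPath {x y : X.Vertex} {σ : List Λ} (h : X.DirPath x σ y) :
    ∃ l : List X.Edge, l.map X.label = σ ∧ X.IsPath x (l.map fun e => (e, true)) y ∧
      X.IsPath y (l.reverse.map fun e => (e, false)) x := by
  induction σ generalizing x with
  | nil => cases h; exact ⟨[], rfl, rfl, rfl⟩
  | cons a σ ih =>
    obtain ⟨e, rfl, rfl, h₃⟩ := h
    obtain ⟨l, rfl, h₄, h₅⟩ := ih h₃
    refine ⟨e :: l, rfl, ⟨by simp [stepSource], by simpa [stepTarget] using h₄⟩, ?_⟩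
    rw [List.reverse_cons, List.map_append]
    exact isPath_append h₅ ⟨by simp [stepSource], by simp [stepTarget, IsPath]⟩

/-- The value of an edge path in a group, for a labeling of the edges by group elements. -/
def holonomy {G : Type*} [Group G] (γ : X.Edge → G) (l : List (X.Edge × Bool)) : G :=
  (l.map fun s => if s.2 then γ s.1 else (γ s.1)⁻¹).prod

theorem holonomy_append {G : Type*} [Group G] (γ : X.Edge → G) (l l' : List (X.Edge × Bool)) :
    holonomy γ (l ++ l') = holonomy γ l * holonomy γ l' := by
  simp [holonomy]

theorem holonomy_forward {G : Type*} [Group G] (γ : X.Edge → G) (l : List X.Edge) :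
    holonomy γ (l.map fun e => (e, true)) = (l.map γ).prod := by
  simp [holonomy, Function.comp_def]

theorem holonomy_backward {G : Type*} [Group G] (γ : X.Edge → G) (l : List X.Edge) :
    holonomy γ (l.reverse.map fun e => (e, false)) = ((l.map γ).prod)⁻¹ := by
  simp [holonomy, Function.comp_def, List.prod_inv_reverse]

/-- Holonomy that is trivial around squares is a homotopy invariant. -/
theorem Homotopic.holonomy_eq {G : Type*} [Group G] {γ : X.Edge → G}
    (hγ : ∀ e f e' f', X.IsSquare e f e' f' → γ e * γ f' = γ f * γ e')
    {x y : X.Vertex} {l l' : List (X.Edge × Bool)} (h : X.Homotopic x y l l') :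
    holonomy γ l = holonomy γ l' := by
  induction h with
  | rel l l' h =>
    rcases h.2.2 with ⟨p, q, ⟨e, b⟩, rfl, rfl⟩ | ⟨p, q, e, f, e', f', hs, rfl, rfl⟩
    · cases b <;> simp [holonomy]
    · have := hγ e f e' f' hs
      simp only [holonomy, List.map_append, List.map_cons, List.prod_append, List.prod_cons,
        if_true]
      rw [← mul_assoc (γ e), this, mul_assoc]
  | refl => rfl
  | symm _ _ _ ih => exact ih.symm
  | trans _ _ _ _ _ ih ih' => exact ih.trans ih'

/-- In a simply connected complex whose squares are compatible with an independence relation,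
directed paths with the same ends spell the same trace. -/
theorem SimplyConnected.trace_eq (hX : X.SimplyConnected) (M : TraceAlphabet Λ)
    (hM : ∀ e f e' f', X.IsSquare e f e' f' → M.indep (X.label e) (X.label f) ∧
      X.label e' = X.label e ∧ X.label f' = X.label f)
    {x y : X.Vertex} {σ τ : List Λ} (hσ : X.DirPath x σ y) (hτ : X.DirPath x τ y) :
    M.trace σ = M.trace τ := by
  classical
  refine M.trace_eq_of_proj fun a b hab => ?_
  -- At most one of two independent labels survives, so the images of the two labels of a square
  -- commute.
  let δ : Λ → FreeGroup Λ := fun x => if x = a ∨ x = b then FreeGroup.of x else 1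
  have hδ : ∀ σ : List Λ, (σ.map δ).prod =
      FreeGroup.mk ((TraceAlphabet.proj a b σ).map fun x => (x, true)) := by
    intro σ
    induction σ with
    | nil => rfl
    | cons x σ ih =>
      rw [TraceAlphabet.proj_cons, List.map_cons, List.prod_cons, ih]
      by_cases hx : x = a ∨ x = b
      · rw [TraceAlphabet.proj_singleton_of_mem hx]
        simp [δ, hx, FreeGroup.of]
      · rw [TraceAlphabet.proj_singleton_of_not_mem hx]
        simp [δ, hx]
  have hγ : ∀ e f e' f', X.IsSquare e f e' f' →
      δ (X.label e) * δ (X.label f') = δ (X.label f) * δ (X.label e') := by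
    intro e f e' f' hs
    obtain ⟨hi, h₁, h₂⟩ := hM e f e' f' hs
    rw [h₁, h₂]
    simp only [δ]
    by_cases he : X.label e = a ∨ X.label e = b
    · by_cases hf : X.label f = a ∨ X.label f = b
      · exfalso
        have hi' := M.symm _ _ hi
        rcases he with he | he <;> rcases hf with hf | hf <;> rw [he, hf] at hi hi' <;>
          first | exact M.irrefl _ hi | exact hab hi | exact hab hi'
      · simp [hf]
    · simp [he]
  obtain ⟨l, rfl, h₁, -⟩ := hσ.exists_isPath
  obtain ⟨l', rfl, -, h₂⟩ := hτ.exists_isPath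
  have h := (hX.2.2 x _ (isPath_append h₁ h₂)).holonomy_eq (γ := fun e => δ (X.label e)) hγ
  rw [holonomy_append, holonomy_forward, holonomy_backward] at h
  have h' : ((l.map X.label).map δ).prod = ((l'.map X.label).map δ).prod := by
    simpa [Function.comp_def, holonomy, mul_inv_eq_one] using h
  rw [hδ, hδ] at h'
  -- A positive word is reduced, so equality in the free group is equality of words.
  have hred : ∀ ρ : List Λ, FreeGroup.reduce (ρ.map fun x => (x, true)) =
      ρ.map fun x => (x, true) := fun ρ => by
    refine FreeGroup.IsReduced.reduce_eq ?_
    induction ρ with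
    | nil => exact .nil
    | cons x ρ ih =>
      cases ρ with
      | nil => exact .singleton
      | cons z ρ => exact List.isChain_cons_cons.2 ⟨fun _ => rfl, ih⟩
  have h'' := congrArg FreeGroup.toWord h'
  rw [FreeGroup.toWord_mk, FreeGroup.toWord_mk, hred, hred] at h''
  exact List.map_injective_iff.2 (fun x y hxy => congrArg Prod.fst hxy) h''

end DirectedSquareComplex

/-! ### The principal filter in the universal cover -/

namespace NetSystem

variable {S : Type u} {T : Type v} {N : NetSystem S T}

theorem Arc.ext_of_fires {e f : N.Arc} (h₁ : e.source = f.source) (h₂ : e.action = f.action) :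
    e = f := by
  obtain ⟨m, a, m', h⟩ := e
  obtain ⟨n, b, n', h'⟩ := f
  simp only at h₁ h₂
  subst h₁ h₂
  have : m' = n' := Subtype.ext (h.unique h')
  subst this
  rfl

/-- The arc of an enabled transition. -/
theorem exists_arc (m : N.Marking) {a : T} {m' : Set S} (h : N.Fires m.1 a m') :
    ∃ e : N.Arc, e.source = m ∧ e.action = a ∧ e.target.1 = m' :=
  ⟨⟨m, a, ⟨m', m.2.trans _ _ _ (.rel _ _ ⟨a, h⟩)⟩, h⟩, rfl, rfl, rfl⟩

variable {Y : DirectedSquareComplex.{u₂, v₂} T} {φ : DirectedSquareComplex.Hom Y N.complex}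

/-- Firing is deterministic, so the images coincide; a covering is injective on outgoing edges. -/
theorem covering_edge_unique (hφ : φ.IsCovering) {d e : Y.Edge}
    (h₁ : Y.source d = Y.source e) (h₂ : Y.label d = Y.label e) : d = e := by
  refine (hφ.outgoing (Y.source e)).injOn h₁ rfl (Arc.ext_of_fires ?_ ?_)
  · exact (φ.source_onEdge d).trans ((congrArg φ.onVertex h₁).trans (φ.source_onEdge e).symm)
  · exact (φ.label_onEdge d).trans (h₂.trans (φ.label_onEdge e).symm)

theorem fires_onVertex (e : Y.Edge) :
    N.Fires (φ.onVertex (Y.source e)).1 (Y.label e) (φ.onVertex (Y.target e)).1 := by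
  rw [← φ.source_onEdge, ← φ.target_onEdge, ← φ.label_onEdge]
  exact (φ.onEdge e).fires

theorem exists_edge_of_fires (hφ : φ.IsCovering) (y : Y.Vertex) {a : T} {m : Set S}
    (h : N.Fires (φ.onVertex y).1 a m) :
    ∃ e, Y.source e = y ∧ Y.label e = a ∧ (φ.onVertex (Y.target e)).1 = m := by
  obtain ⟨f, h₁, h₂, h₃⟩ := exists_arc _ h
  obtain ⟨e, he, rfl⟩ := (hφ.outgoing y).surjOn h₁
  refine ⟨e, he, ?_, ?_⟩
  · rw [← φ.label_onEdge]; exact h₂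
  · rw [← φ.target_onEdge]; exact h₃

theorem firesWord_of_dirPath (φ : DirectedSquareComplex.Hom Y N.complex) {y y' : Y.Vertex}
    {σ : List T} (h : Y.DirPath y σ y') :
    N.FiresWord (φ.onVertex y).1 σ (φ.onVertex y').1 := by
  induction σ generalizing y with
  | nil => cases h; rfl
  | cons a σ ih =>
    obtain ⟨e, rfl, rfl, h₃⟩ := h
    exact ⟨_, fires_onVertex e, ih h₃⟩

theorem exists_dirPath_of_firesWord (hφ : φ.IsCovering) {y : Y.Vertex} {σ : List T} {m : Set S}
    (h : N.FiresWord (φ.onVertex y).1 σ m) : ∃ y', Y.DirPath y σ y' := by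
  induction σ generalizing y with
  | nil => exact ⟨y, rfl⟩
  | cons a σ ih =>
    obtain ⟨m₁, h₁, h₂⟩ := h
    obtain ⟨e, he, hl, rfl⟩ := exists_edge_of_fires hφ y h₁
    obtain ⟨y', hy'⟩ := ih h₂
    exact ⟨y', e, he, hl, hy'⟩

theorem dirPath_unique (hφ : φ.IsCovering) {y y₁ y₂ : Y.Vertex} {σ : List T}
    (h₁ : Y.DirPath y σ y₁) (h₂ : Y.DirPath y σ y₂) : y₁ = y₂ := by
  induction σ generalizing y with
  | nil => exact h₁.symm.trans h₂
  | cons a σ ih =>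
    obtain ⟨e, he, hl, h₁⟩ := h₁
    obtain ⟨e', he', hl', h₂⟩ := h₂
    obtain rfl := covering_edge_unique hφ (he.trans he'.symm) (hl.trans hl'.symm)
    exact ih h₁ h₂

/-- Swapping the two firings completes the image path to a square of the base. Lifting that square
at the start of the path gives the other side, with the same end. -/
theorem dirPath_swap (hφ : φ.IsCovering) {y y' : Y.Vertex} {a b : T}
    (hab : N.alphabet.indep a b) (h : Y.DirPath y [a, b] y') : Y.DirPath y [b, a] y' := by
  obtain ⟨e, rfl, rfl, f', hf', rfl, rfl⟩ := h
  have hf := fires_onVertex (φ := φ) f'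
  rw [hf'] at hf
  obtain ⟨m, h₁, h₂⟩ := (fires_onVertex (φ := φ) e).swap hab hf
  obtain ⟨f, hfs, hfa, hft⟩ := exists_arc _ h₁
  subst hft
  obtain ⟨e', hes, hea, het⟩ := exists_arc f.target h₂
  have hsq : N.complex.IsSquare (φ.onEdge e) f e' (φ.onEdge f') := by
    refine ⟨?_, hea.trans (φ.label_onEdge e).symm, (φ.label_onEdge f').trans hfa.symm,
      (φ.source_onEdge e).trans hfs.symm, ?_, hes.symm,
      Subtype.ext (het.trans (congrArg Subtype.val (φ.target_onEdge f')).symm)⟩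
    · rw [hfa, show (φ.onEdge e).action = Y.label e from φ.label_onEdge e]
      exact hab
    · exact (φ.target_onEdge e).trans ((congrArg φ.onVertex hf'.symm).trans
        (φ.source_onEdge f').symm)
  obtain ⟨d, g, d', g', hY, hd, hde, rfl, rfl, hgf⟩ :=
    hφ.square_at_source (Y.source e) _ _ _ _ hsq (φ.source_onEdge e)
  have hlab : ∀ {d e : Y.Edge}, φ.onEdge d = φ.onEdge e → Y.label d = Y.label e := fun h => by
    rw [← φ.label_onEdge, ← φ.label_onEdge, h]
  -- The lifted square contains the given path, by uniqueness of lifted edges.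
  obtain rfl := covering_edge_unique hφ hd (hlab hde)
  obtain rfl := covering_edge_unique hφ
    ((Y.square_side _ _ _ _ hY).symm.trans hf'.symm) (hlab hgf)
  refine ⟨g, (Y.square_source _ _ _ _ hY).symm, ?_, d', ?_, ?_, Y.square_sink _ _ _ _ hY⟩
  · rw [← φ.label_onEdge]; exact hfa
  · exact (Y.square_side _ _ _ _ (Y.square_swap _ _ _ _ hY)).symm
  · rw [← φ.label_onEdge]; exact hea

theorem dirPath_of_trace_eq (hφ : φ.IsCovering) {y y' : Y.Vertex} {σ τ : List T}
    (h : Y.DirPath y σ y') (hστ : N.alphabet.trace σ = N.alphabet.trace τ) :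
    Y.DirPath y τ y' := by
  replace hστ := N.alphabet.trace_eq_iff.1 hστ
  induction hστ with
  | refl => exact h
  | tail _ hs ih =>
    obtain ⟨α, β, a, b, hab, rfl, rfl⟩ := hs
    obtain ⟨z, h₁, h₂⟩ := DirectedSquareComplex.dirPath_append.1 ih
    obtain ⟨z', h₃, h₄⟩ := DirectedSquareComplex.dirPath_append (σ := [a, b]).1 h₂
    exact DirectedSquareComplex.dirPath_append.2 ⟨z, h₁,
      DirectedSquareComplex.dirPath_append (σ := [b, a]).2 ⟨z', dirPath_swap hφ hab h₃, h₄⟩⟩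

theorem trace_eq_of_dirPath (hφ : φ.IsUniversalCover) {y y' : Y.Vertex} {σ τ : List T}
    (hσ : Y.DirPath y σ y') (hτ : Y.DirPath y τ y') :
    N.alphabet.trace σ = N.alphabet.trace τ := by
  refine hφ.2.trace_eq N.alphabet (fun e f e' f' hs => ?_) hσ hτ
  obtain ⟨h₁, h₂, h₃, _⟩ := φ.square_onEdge e f e' f' hs
  rw [← φ.label_onEdge, ← φ.label_onEdge, ← φ.label_onEdge, ← φ.label_onEdge]
  exact ⟨h₁, h₂, h₃⟩

/-- The vertices of the principal filter of a lift of the initial marking in the universal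
cover correspond to the firing traces. -/
theorem exists_filter_equiv (hφ : φ.IsUniversalCover) {y₀ : Y.Vertex}
    (hy₀ : φ.onVertex y₀ = N.initialMarking) :
    ∃ h : Y.filter y₀ ≃ N.firingTraces,
      (∀ x y, Y.DirReach x.1 y.1 ↔ N.alphabet.Prefix (h x).1 (h y).1) ∧
      ∀ x a y, (∃ ε, Y.source ε = x.1 ∧ Y.target ε = y.1 ∧ Y.label ε = a) ↔
        N.alphabet.Extends (h x).1 a (h y).1 := by
  have hinit : (φ.onVertex y₀).1 = N.initial := congrArg Subtype.val hy₀
  -- Any word leading to `x` will do: by `hpath` below, such words form exactly one trace.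
  choose w hw using fun x : Y.filter y₀ => DirectedSquareComplex.dirReach_iff.1 x.2
  have hfire : ∀ x, N.alphabet.trace (w x) ∈ N.firingTraces := fun x =>
    N.trace_mem_firingTraces.2 ⟨_, hinit ▸ firesWord_of_dirPath φ (hw x)⟩
  let h : Y.filter y₀ → N.firingTraces := fun x => ⟨N.alphabet.trace (w x), hfire x⟩
  have hpath : ∀ (x : Y.filter y₀) σ,
      Y.DirPath y₀ σ x.1 ↔ N.alphabet.trace σ = (h x).1 := fun x σ =>
    ⟨fun hσ => trace_eq_of_dirPath hφ hσ (hw x), fun hσ => dirPath_of_trace_eq hφ.1 (hw x) hσ.symm⟩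
  have hbij : Function.Bijective h := by
    refine ⟨fun x y hxy => Subtype.ext ?_, ?_⟩
    · exact dirPath_unique hφ.1 ((hpath x (w y)).2 (congrArg Subtype.val hxy).symm) (hw y)
    · rintro ⟨t, ht⟩
      obtain ⟨σ, rfl⟩ := N.alphabet.exists_trace t
      obtain ⟨m, hm⟩ := N.trace_mem_firingTraces.1 ht
      rw [← hinit] at hm
      obtain ⟨y, hy⟩ := exists_dirPath_of_firesWord hφ.1 hm
      refine ⟨⟨y, DirectedSquareComplex.dirReach_iff.2 ⟨σ, hy⟩⟩, Subtype.ext ?_⟩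
      exact ((hpath _ σ).1 hy).symm
  have hrel : ∀ (x y : Y.filter y₀) σ,
      Y.DirPath x.1 σ y.1 ↔ N.alphabet.trace (w x ++ σ) = (h y).1 := by
    intro x y σ
    rw [← hpath, DirectedSquareComplex.dirPath_append]
    refine ⟨fun hσ => ⟨x.1, hw x, hσ⟩, fun ⟨z, h₁, h₂⟩ => ?_⟩
    rwa [dirPath_unique hφ.1 h₁ (hw x)] at h₂
  refine ⟨Equiv.ofBijective h hbij, fun x y => ?_, fun x a y => ?_⟩
  · rw [DirectedSquareComplex.dirReach_iff]
    exact (exists_congr fun σ => hrel x y σ).trans N.alphabet.prefix_iff.symm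
  · rw [← DirectedSquareComplex.dirPath_singleton]
    exact (hrel x y [a]).trans N.alphabet.extends_iff.symm

end NetSystem

/-! ### Path lengths in the covering graph, and events as configurations `↓e` -/

namespace LabeledEventStructure

variable {Λ : Type v} {E : LabeledEventStructure.{u} Λ}

theorem PathWord.concat {c d c' : E.Config} {σ : List Λ} {a : Λ} (h : E.PathWord c σ d)
    (h' : E.HasseEdge d a c' ∨ E.HasseEdge c' a d) : E.PathWord c (σ ++ [a]) c' := by
  induction σ generalizing c with
  | nil => cases h; exact ⟨c', h', rfl⟩
  | cons b σ ih =>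
    obtain ⟨d', h₁, h₂⟩ := h
    exact ⟨d', h₁, ih h₂⟩

theorem PathWord.exists_of_concat {c c' : E.Config} {σ : List Λ} {a : Λ}
    (h : E.PathWord c (σ ++ [a]) c') :
    ∃ d, E.PathWord c σ d ∧ (E.HasseEdge d a c' ∨ E.HasseEdge c' a d) := by
  induction σ generalizing c with
  | nil =>
    obtain ⟨d, h₁, rfl⟩ := h
    exact ⟨c, rfl, h₁⟩
  | cons b σ ih =>
    obtain ⟨d', h₁, h₂⟩ := h
    obtain ⟨d, h₃, h₄⟩ := ih h₂
    exact ⟨d, ⟨d', h₁, h₃⟩, h₄⟩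

theorem HasseEdge.ncard_eq {c c' : E.Config} {a : Λ} (h : E.HasseEdge c a c') :
    c'.carrier.ncard = c.carrier.ncard + 1 := by
  obtain ⟨e, he, hc, _⟩ := h
  rw [hc, Set.ncard_insert_of_notMem he c.finite]

/-- Each step adds or removes a single event. -/
theorem PathWord.ncard_le {c : E.Config} {σ : List Λ} (h : E.PathWord E.emptyConfig σ c) :
    c.carrier.ncard ≤ σ.length := by
  induction σ using List.reverseRecOn generalizing c with
  | nil => cases h; simp [emptyConfig]
  | append_singleton σ a ih =>
    obtain ⟨d, h₁, h₂ | h₂⟩ := h.exists_of_concat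
    · have := ih h₁; have := h₂.ncard_eq; simp; omega
    · have := ih h₁; have := h₂.ncard_eq; simp; omega

/-- If `e` and `e'` are not in conflict, then `↓e ∪ ↓e'` is a configuration, since a conflict inside
it would be inherited by `e` and `e'`. Conflict is thus visible in the domain. -/
theorem conflict_iff_not_exists_config {e e' : E.Event} :
    E.conflict e e' ↔ ¬ ∃ c : E.Config, e ∈ c.carrier ∧ e' ∈ c.carrier := by
  refine ⟨fun h ⟨c, h₁, h₂⟩ => c.conflictFree e h₁ e' h₂ h, fun h => ?_⟩
  by_contra hc
  have hcross : ∀ x y, E.le x e → E.le y e' → ¬ E.conflict x y := fun x y hx hy hxy =>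
    hc (E.conflict_symm _ _ (E.conflict_of_le _ _ _
      (E.conflict_symm _ _ (E.conflict_of_le _ _ _ hxy hy)) hx))
  refine h ⟨⟨(E.below e).carrier ∪ (E.below e').carrier, (E.below e).finite.union
    (E.below e').finite, ?_, ?_⟩, Or.inl (E.le_refl e), Or.inr (E.le_refl e')⟩
  · rintro x (hx | hx) y (hy | hy) hxy
    · exact (E.below e).conflictFree x hx y hy hxy
    · exact hcross x y hx hy hxy
    · exact hcross y x hy hx (E.conflict_symm _ _ hxy)
    · exact (E.below e').conflictFree x hx y hy hxy
  · rintro x (hx | hx) y hy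
    · exact Or.inl ((E.below e).downClosed x hx y hy)
    · exact Or.inr ((E.below e').downClosed x hx y hy)

theorem below_subset_iff {e : E.Event} {c : E.Config} :
    (E.below e).carrier ⊆ c.carrier ↔ e ∈ c.carrier :=
  ⟨fun h => h (E.le_refl e), fun h x hx => c.downClosed e h x hx⟩

theorem below_injective : Function.Injective E.below := fun e e' h =>
  E.le_antisymm _ _ (below_subset_iff.1 (h ▸ subset_rfl) : e ∈ (E.below e').carrier)
    (below_subset_iff.1 (h ▸ subset_rfl) : e' ∈ (E.below e).carrier)

end LabeledEventStructure

/-! ### Event structures whose domain is the poset of firing traces -/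

namespace NetSystem

variable {S : Type u} {T : Type v} {N : NetSystem S T} {E : LabeledEventStructure.{w} T}
  {g : E.Config ≃ N.firingTraces}

namespace IsTraceDomain

theorem apply_empty (hg : N.IsTraceDomain E g) :
    (g E.emptyConfig).1 = N.alphabet.trace [] := by
  have hf : N.alphabet.trace [] ∈ N.firingTraces := N.trace_mem_firingTraces.2 ⟨_, rfl⟩
  have h := (hg.1 E.emptyConfig (g.symm ⟨_, hf⟩)).1 (Set.empty_subset _)
  rw [g.apply_symm_apply] at h
  obtain ⟨σ, hσ⟩ := N.alphabet.exists_trace (g E.emptyConfig).1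
  rw [← hσ] at h ⊢
  exact N.alphabet.prefix_antisymm h (N.alphabet.prefix_append [] σ)

theorem pathWord_of_trace_eq (hg : N.IsTraceDomain E g) {c : E.Config} {σ : List T}
    (h : N.alphabet.trace σ = (g c).1) :
    E.PathWord E.emptyConfig σ c ∧ c.carrier.ncard = σ.length := by
  induction σ using List.reverseRecOn generalizing c with
  | nil =>
    obtain rfl : E.emptyConfig = c := g.injective (Subtype.ext (hg.apply_empty.trans h))
    exact ⟨rfl, by simp [LabeledEventStructure.emptyConfig]⟩
  | append_singleton σ a ih =>
    have hf : N.alphabet.trace σ ∈ N.firingTraces :=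
      N.firingTraces_of_prefix (g c).2 (h ▸ N.alphabet.prefix_append σ [a])
    have hd : N.alphabet.trace σ = (g (g.symm ⟨_, hf⟩)).1 := by rw [g.apply_symm_apply]
    obtain ⟨h₁, h₂⟩ := ih hd
    have hedge := (hg.2 (g.symm ⟨_, hf⟩) a c).2 ⟨σ, hd, h⟩
    exact ⟨h₁.concat (Or.inl hedge), by rw [hedge.ncard_eq, h₂]; simp⟩

theorem trace_eq_of_pathWord (hg : N.IsTraceDomain E g) {c : E.Config} {σ : List T}
    (h : E.PathWord E.emptyConfig σ c) (hlen : c.carrier.ncard = σ.length) :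
    N.alphabet.trace σ = (g c).1 := by
  induction σ using List.reverseRecOn generalizing c with
  | nil => cases h; exact hg.apply_empty.symm
  | append_singleton σ a ih =>
    obtain ⟨d, h₁, h₂ | h₂⟩ := h.exists_of_concat
    · have hn := h₂.ncard_eq
      have hd := ih h₁ (by simp at hlen; omega)
      obtain ⟨τ, h₃, h₄⟩ := (hg.2 d a c).1 h₂
      rw [← h₄]
      exact N.alphabet.trace_append_congr (hd.trans h₃.symm) rfl
    -- A final descending step is too expensive: the configuration before it has more events than
    -- the path so far has steps.
    · have := h₁.ncard_le
      have := h₂.ncard_eq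
      simp at hlen
      omega

theorem isGeodesicWord_iff (hg : N.IsTraceDomain E g) (c : E.Config) (σ : List T) :
    E.IsGeodesicWord c σ ↔ N.alphabet.trace σ = (g c).1 := by
  constructor
  · rintro ⟨h₁, h₂⟩
    obtain ⟨τ, hτ⟩ := N.alphabet.exists_trace (g c).1
    obtain ⟨h₃, h₄⟩ := hg.pathWord_of_trace_eq hτ
    have := h₂ τ h₃
    have := h₁.ncard_le
    exact hg.trace_eq_of_pathWord h₁ (by omega)
  · intro h
    obtain ⟨h₁, h₂⟩ := hg.pathWord_of_trace_eq h
    exact ⟨h₁, fun τ hτ => h₂ ▸ hτ.ncard_le⟩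

theorem geodesicTraces_eq (hg : N.IsTraceDomain E g) :
    E.geodesicTraces N.alphabet = N.firingTraces := by
  ext t
  constructor
  · rintro ⟨c, σ, h, rfl⟩
    rw [(hg.isGeodesicWord_iff c σ).1 h]
    exact (g c).2
  · intro ht
    obtain ⟨σ, rfl⟩ := N.alphabet.exists_trace t
    exact ⟨g.symm ⟨_, ht⟩, σ, (hg.isGeodesicWord_iff _ σ).2 (by rw [g.apply_symm_apply]), rfl⟩

/-- The configurations `↓e` correspond to prime traces with last letter the label of `e`. -/
theorem isPrimeWord_below (hg : N.IsTraceDomain E g) (e : E.Event) {p : List T}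
    (hp : N.alphabet.trace p = (g (E.below e)).1) :
    N.alphabet.IsPrimeWord (E.label e) p := by
  intro σ hσ
  rw [hp] at hσ
  rcases List.eq_nil_or_concat' σ with rfl | ⟨σ, a, rfl⟩
  · have h := g.injective (Subtype.ext (hg.apply_empty.trans hσ))
    exact absurd (h ▸ E.le_refl e : e ∈ E.emptyConfig.carrier) (Set.notMem_empty e)
  · have hf : N.alphabet.trace σ ∈ N.firingTraces :=
      N.firingTraces_of_prefix (g (E.below e)).2 (hσ ▸ N.alphabet.prefix_append σ [a])
    obtain ⟨e', h₁, h₂, rfl⟩ := (hg.2 (g.symm ⟨_, hf⟩) a (E.below e)).2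
      ⟨σ, by rw [g.apply_symm_apply], hσ⟩
    -- The event added last must be `e`; otherwise the smaller configuration contains `e`, hence all
    -- of `↓e`, including `e'`.
    have he : e ∈ insert e' (g.symm ⟨_, hf⟩).carrier := h₂ ▸ E.le_refl e
    rcases he with rfl | he
    · simp
    · exact absurd (LabeledEventStructure.below_subset_iff.2 he (h₂ ▸ Set.mem_insert e' _)) h₁

/-- Removing any maximal event of `c` removes a final `a` from the trace. By cancellation the
results agree, so `c` has only one maximal event and every event lies below it. -/
theorem exists_below_of_isPrimeWord (hg : N.IsTraceDomain E g) {c : E.Config} {a : T}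
    {p : List T} (hp : N.alphabet.IsPrimeWord a p) (hpc : N.alphabet.trace p = (g c).1) :
    ∃ e, E.below e = c := by
  have hmax : ∀ e ∈ c.carrier, ∀ h : (∀ e' ∈ c.carrier, E.le e e' → e' = e),
      ∃ σ, N.alphabet.trace σ = (g (c.erase e h)).1 ∧
        N.alphabet.trace (σ ++ [a]) = N.alphabet.trace p := by
    intro e he h
    obtain ⟨σ, h₁, h₂⟩ := (hg.2 _ _ _).1 (c.hasseEdge_erase he h)
    rw [← hpc] at h₂
    obtain rfl := hp.eq_of_concat h₂.symm
    exact ⟨σ, h₁, h₂⟩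
  have hne : c.carrier.Nonempty := by
    rw [Set.nonempty_iff_ne_empty]
    intro h
    obtain rfl : c = E.emptyConfig := LabeledEventStructure.Config.ext_carrier h
    obtain ⟨p', rfl⟩ := hp.exists_eq
    simpa using N.alphabet.trace_length_eq (hpc.trans hg.apply_empty)
  obtain ⟨x, hx⟩ := hne
  obtain ⟨e, he, _, hem⟩ := c.exists_maximal_above hx
  refine ⟨e, LabeledEventStructure.Config.ext_carrier (Set.Subset.antisymm
    (LabeledEventStructure.below_subset_iff.2 he) fun y hy => ?_)⟩
  obtain ⟨e', he', hye', hem'⟩ := c.exists_maximal_above hy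
  obtain ⟨σ, h₁, h₂⟩ := hmax e he hem
  obtain ⟨σ', h₁', h₂'⟩ := hmax e' he' hem'
  have hσ := N.alphabet.trace_cancel_right (h₂.trans h₂'.symm)
  have hc : c.erase e hem = c.erase e' hem' :=
    g.injective (Subtype.ext (h₁.symm.trans (hσ.trans h₁')))
  have hee : e = e' := by
    by_contra hne
    have : e ∈ (c.erase e' hem').carrier := ⟨he, hne⟩
    rw [← hc] at this
    exact this.2 rfl
  subst hee
  exact hye'

/-- The events of `E` correspond to the prime firing traces. -/
theorem exists_iso [Finite T] (hg : N.IsTraceDomain E g) :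
    ∃ f : N.unfolding.Iso E, ∀ e : N.unfolding.Event, (g (E.below (f.toEquiv e))).1 = e.1 := by
  have hex : ∀ e : N.unfolding.Event, ∃ e' : E.Event,
      (g (E.below e')).1 = e.1 ∧ E.label e' = N.unfolding.label e := by
    intro e
    obtain ⟨p, hp, hpe⟩ := N.unfolding_event_word e
    have hc : N.alphabet.trace (p ++ [N.unfolding.label e]) = (g (g.symm ⟨e.1, e.2.1⟩)).1 := by
      rw [g.apply_symm_apply, hpe]
    obtain ⟨e', he'⟩ := hg.exists_below_of_isPrimeWord hp hc
    refine ⟨e', by rw [he', g.apply_symm_apply], ?_⟩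
    have := hg.isPrimeWord_below e' (hc.trans (by rw [he'])) _ rfl
    simpa using this.symm
  choose F hF hlab using hex
  have hbij : Function.Bijective F := by
    refine ⟨fun e e' h => Subtype.ext ((hF e).symm.trans (h ▸ hF e')), fun e' => ?_⟩
    obtain ⟨p, hp⟩ := N.alphabet.exists_trace (g (E.below e')).1
    refine ⟨⟨(g (E.below e')).1, (g (E.below e')).2, hp ▸ ⟨_, hg.isPrimeWord_below e' hp⟩⟩, ?_⟩
    exact LabeledEventStructure.below_injective (g.injective (Subtype.ext (hF _)))
  -- Taking `c` of the form `↓e'` gives the order; letting `c` vary gives the conflict relation.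
  have hmem : ∀ e c, F e ∈ c.carrier ↔ N.alphabet.Prefix e.1 (g c).1 := fun e c => by
    rw [← LabeledEventStructure.below_subset_iff, hg.1, hF]
  refine ⟨⟨Equiv.ofBijective F hbij, fun e e' => ?_, fun e e' => ?_, hlab⟩, hF⟩
  · have := hmem e (E.below (F e'))
    rw [hF] at this
    exact this.symm
  · refine Iff.trans (not_congr ⟨?_, ?_⟩)
      LabeledEventStructure.conflict_iff_not_exists_config.symm
    · rintro ⟨t, ht, h₁, h₂⟩
      refine ⟨g.symm ⟨t, ht⟩, (hmem e _).2 ?_, (hmem e' _).2 ?_⟩ <;> rwa [g.apply_symm_apply]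
    · rintro ⟨c, h₁, h₂⟩
      exact ⟨_, (g c).2, (hmem e c).1 h₁, (hmem e' c).1 h₂⟩

end IsTraceDomain

end NetSystem

/-! ### Transfer to the universal cover and conclusion -/

namespace NetSystem

variable {S : Type u} {T : Type v} {N : NetSystem S T}

/-- The domain of `E` is the principal filter of a lift of the initial marking if and only if it
is the poset of firing traces. -/
theorem hasDomain_iff_isTraceDomain {Y : DirectedSquareComplex.{u₂, v₂} T}
    {φ : DirectedSquareComplex.Hom Y N.complex} (hφ : φ.IsUniversalCover) {y₀ : Y.Vertex}
    (hy₀ : φ.onVertex y₀ = N.initialMarking) (E : LabeledEventStructure.{w} T) :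
    E.HasDomain Y y₀ ↔ ∃ g, N.IsTraceDomain E g := by
  obtain ⟨h, h₁, h₂⟩ := exists_filter_equiv hφ hy₀
  constructor
  · rintro ⟨θ, h₃, h₄⟩
    exact ⟨θ.trans h, fun c c' => (h₃ c c').trans (h₁ _ _),
      fun c a c' => (h₄ c a c').trans (h₂ _ _ _)⟩
  · rintro ⟨g, h₃, h₄⟩
    refine ⟨g.trans h.symm, fun c c' => ?_, fun c a c' => ?_⟩
    · rw [h₁, h₃]; simp
    · rw [h₂, h₄]; simp

end NetSystem

theorem mainTheorem2 {S : Type u} {T : Type v} [Finite S] [Finite T] (N : NetSystem S T)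
    (Y : DirectedSquareComplex.{u₂, v₂} T) (φ : DirectedSquareComplex.Hom Y N.complex)
    (hφ : φ.IsUniversalCover)
    (y₀ : Y.Vertex) (hy₀ : φ.onVertex y₀ = N.initialMarking) :
    (∃ E' : LabeledEventStructure.{v} T, E'.HasDomain Y y₀) ∧
    ∀ E' : LabeledEventStructure.{w} T, E'.HasDomain Y y₀ →
      E'.geodesicTraces N.alphabet = N.firingTraces ∧
      ∃ (g : E'.Config ≃ N.firingTraces) (f : N.unfolding.Iso E'),
        (∀ (c : E'.Config) (σ : List T),
          E'.IsGeodesicWord c σ ↔ N.alphabet.trace σ = (g c).1) ∧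
        ∀ e : N.unfolding.Event, (g (E'.below (f.toEquiv e))).1 = e.1 := by
  -- The unfolding itself witnesses existence.
  refine ⟨⟨N.unfolding, (NetSystem.hasDomain_iff_isTraceDomain hφ hy₀ _).2
    N.exists_isTraceDomain_unfolding⟩, fun E' hE' => ?_⟩
  obtain ⟨g, hg⟩ := (NetSystem.hasDomain_iff_isTraceDomain hφ hy₀ _).1 hE'
  obtain ⟨f, hf⟩ := hg.exists_iso
  exact ⟨hg.geodesicTraces_eq, g, f, hg.isGeodesicWord_iff, hf⟩
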